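/- All graphs are finite, undirected and have a loop at every vertex; a component is a maximal connected subgraph, an isolated vertex is a component with one vertex, and a graph is complete if any two distinct vertices are adjacent. The image of a subgraph under a map of vertices has as vertices and edges the images of its vertices and edges. For a finite group $G$, the proper power graph $P_0(G)$ has vertex set $G\setminus\{1\}$, with $x,y$ adjacent if one is a power of the other. Write $[x]$ for the class of $x$ under the relation $\langle x\rangle=\langle y\rangle$. The proper quotient power graph $\widetilde P_0(G)$ has vertices $[x]$, $x\in G\setminus\{1\}$, with two classes adjacent if they have adjacent representatives; the order of $[x]$ is the order $o(x)$. The proper order graph $\mathcal O_0(G)$ has as vertices the element orders of $G$ different from $1$, with $a,b$ adjacent if $a\mid b$ or $b\mid a$. If $G\le S_n$, the type $T_\psi$ of $\psi\in G$ is the partition of $n$ given by the sizes of its orbits on $\{1,\dots,n\}$. For a partition $T=[x_1,\dots,x_r]$ of $n$ and $a\in\mathbb N$, $T^a$ is the partition having the terms $x_i/\gcd(a,x_i)$ repeated $\gcd(a,x_i)$ times, for all $i$; the order of $T$ is $\operatorname{lcm}(x_1,\dots,x_r)$. The proper power type graph $P_0(\mathcal T(G))$ has as vertices the types different from $[1^n]$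 of elements of $G$, with $S,T$ adjacent if $S=T^a$ or $T=S^a$ for some $a\in\mathbb N$. Put $\widetilde t([\psi])=T_\psi$ and $\widetilde o([\psi])=o(\psi)$. **Theorem B.** Let $P$ be the set of primes, $A=P\cup(P+1)\cup(P+2)\cup 2P\cup(2P+1)$ and let $n\in A$ with $n\ge 11$. Let $\widetilde\Omega_n$ be the component of $\widetilde P_0(A_n)$ containing $[(12)(34)]$. (i) $\widetilde P_0(A_n)$ consists of the main component $\widetilde\Omega_n$ and of at least one further component; every further component is an isolated vertex of prime order, and at most two primes are involved. (ii) $P_0(A_n)$ consists of the main component, which is induced by $\{\psi\in A_n\setminus\{id\}: [\psi]\in V_{\widetilde\Omega_n}\}$, and of at least one further component; every further component is a complete graph on $p-1$ vertices for a prime $p$, and at most two primes $p$ are involved. (iii) $P_0(\mathcal T(A_n))$ consists of the main component $\widetilde t(\widetilde\Omega_n)$ and of at least one further component; every further component is an isolated vertex of prime order, and at most two primes are involved. (iv) $\mathcal O_0(A_n)$ consists of the main component $\widetilde o(\widetilde\Omega_n)$ and of possibly some further components; every further component is an isolated vertex which is a prime, and there are at most two of them. In all the above cases the main component is not a complete graph.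 -/

import Mathlib

namespace AltPowerGraphs

/-! ### General graph constructions

Graphs with a loop at every vertex are represented by their proper edges, i.e. by a `SimpleGraph`. -/

section Graphs

variable {V W : Type*}

/-- The vertex deleted subgraph `X - x₀`. -/
def deleteVertex (X : SimpleGraph V) (x₀ : V) : SimpleGraph {v : V // v ≠ x₀} :=
  X.comap Subtype.val

/-- The quotient graph: two distinct classes are adjacent when they have adjacent representatives. -/
def quotientGraph (X : SimpleGraph V) (s : Setoid V) : SimpleGraph (Quotient s) where
  Adj a b := a ≠ b ∧ ∃ x y : V, Quotient.mk s x = a ∧ Quotient.mk s y = b ∧ X.Adj x y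
  symm := ⟨fun _ _ ⟨hne, x, y, hx, hy, h⟩ => ⟨hne.symm, y, x, hy, hx, h.symm⟩⟩
  loopless := ⟨fun _ h => h.1 rfl⟩

/-- The image of the component `C` of `X` under the vertex map `f` (vertices go to vertices,
edges go to edges or loops) is, as a subgraph of `Y`, the component `D` of `Y`. -/
def IsImageOfComponent (X : SimpleGraph V) (Y : SimpleGraph W) (f : V → W)
    (C : X.ConnectedComponent) (D : Y.ConnectedComponent) : Prop :=
  f '' C.supp = D.supp ∧
  ∀ a ∈ D.supp, ∀ b ∈ D.supp, Y.Adj a b ↔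
    a ≠ b ∧ ∃ x ∈ C.supp, ∃ y ∈ C.supp, X.Adj x y ∧ f x = a ∧ f y = b

/-- The component `C` is a complete graph. -/
def IsCompleteComponent (X : SimpleGraph V) (C : X.ConnectedComponent) : Prop :=
  ∀ x ∈ C.supp, ∀ y ∈ C.supp, x ≠ y → X.Adj x y

/-- Every component of `X` other than `M` is an isolated vertex whose order (given by `ord`) is
a prime, and at most two primes arise in this way. -/
def OthersIsolatedOfPrimeOrder (X : SimpleGraph V) (ord : V → ℕ) (M : X.ConnectedComponent) :
    Prop :=
  (∀ C : X.ConnectedComponent, C ≠ M → ∃ v : V, C.supp = {v} ∧ (ord v).Prime) ∧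
  {p : ℕ | ∃ C : X.ConnectedComponent, C ≠ M ∧ ∃ v ∈ C.supp, ord v = p}.encard ≤ 2

/-- Every component of `X` other than `M` is a complete graph on `p - 1` vertices for some prime
`p`, and at most two primes arise in this way. -/
def OthersCompleteOfPrime (X : SimpleGraph V) (M : X.ConnectedComponent) : Prop :=
  (∀ C : X.ConnectedComponent, C ≠ M →
    IsCompleteComponent X C ∧ ∃ p : ℕ, p.Prime ∧ C.supp.ncard = p - 1) ∧
  {p : ℕ | p.Prime ∧ ∃ C : X.ConnectedComponent, C ≠ M ∧ C.supp.ncard = p - 1}.encard ≤ 2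

end Graphs

/-! ### Power graph, quotient power graph, order graph -/

section Groups

variable (G : Type*) [Group G]

/-- The power graph `P(G)`. -/
def powerGraph : SimpleGraph G where
  Adj x y := x ≠ y ∧ ∃ m : ℕ, x = y ^ m ∨ y = x ^ m
  symm := ⟨fun _ _ ⟨hne, m, h⟩ => ⟨hne.symm, m, h.symm⟩⟩
  loopless := ⟨fun _ h => h.1 rfl⟩

/-- The proper power graph `P₀(G)`. -/
def properPowerGraph : SimpleGraph {x : G // x ≠ 1} := deleteVertex (powerGraph G) 1

/-- `x` and `y` are identified when they generate the same cyclic subgroup. -/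
def cyclicSetoid : Setoid G := Setoid.ker (fun x : G => Subgroup.zpowers x)

/-- The set `[G]` of the classes `[x]`. -/
abbrev CyclicClass : Type _ := Quotient (cyclicSetoid G)

variable {G} in
/-- The class `[x]`. -/
def cls (x : G) : CyclicClass G := Quotient.mk (cyclicSetoid G) x

/-- The quotient power graph of `G`. -/
def quotientPowerGraph : SimpleGraph (CyclicClass G) :=
  quotientGraph (powerGraph G) (cyclicSetoid G)

/-- The proper quotient power graph of `G`. -/
def properQuotientPowerGraph : SimpleGraph {c : CyclicClass G // c ≠ cls 1} :=
  deleteVertex (quotientPowerGraph G) (cls 1)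

variable {G} in
theorem cls_eq_iff {x y : G} : cls x = cls y ↔ Subgroup.zpowers x = Subgroup.zpowers y :=
  Quotient.eq (r := cyclicSetoid G)

variable {G} in
theorem cls_ne_one {x : G} (hx : x ≠ 1) : cls x ≠ cls (1 : G) := by
  intro h
  rw [cls_eq_iff, Subgroup.zpowers_one_eq_bot, Subgroup.zpowers_eq_bot] at h
  exact hx h

variable {G} in
/-- The vertex `[x]` of the proper quotient power graph, for `x ≠ 1`. -/
def properCls (x : {x : G // x ≠ 1}) : {c : CyclicClass G // c ≠ cls 1} :=
  ⟨cls x.1, cls_ne_one x.2⟩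

/-- The set `O(G)` of the orders of the elements of `G`. -/
def orderSet : Set ℕ := Set.range (fun g : G => orderOf g)

/-- The order graph of `G`. -/
def orderGraph : SimpleGraph (orderSet G) where
  Adj a b := a ≠ b ∧ (a.1 ∣ b.1 ∨ b.1 ∣ a.1)
  symm := ⟨fun _ _ ⟨hne, h⟩ => ⟨hne.symm, h.symm⟩⟩
  loopless := ⟨fun _ h => h.1 rfl⟩

/-- `1` as a vertex of the order graph. -/
def orderOne : orderSet G := ⟨1, 1, orderOf_one⟩

/-- The proper order graph of `G`. -/
def properOrderGraph : SimpleGraph {m : orderSet G // m ≠ orderOne G} :=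
  deleteVertex (orderGraph G) (orderOne G)

variable {G} in
theorem orderOf_eq_of_zpowers_eq {x y : G} (h : Subgroup.zpowers x = Subgroup.zpowers y) :
    orderOf x = orderOf y := by
  rw [← Nat.card_zpowers, ← Nat.card_zpowers, h]

variable {G} in
/-- The order of `[x]` is the order of `x`; here as an element of `O(G)`. -/
noncomputable def clsOrder (c : CyclicClass G) : orderSet G :=
  Quotient.lift (s := cyclicSetoid G) (fun x : G => (⟨orderOf x, x, rfl⟩ : orderSet G))
    (fun _ _ h => Subtype.ext (orderOf_eq_of_zpowers_eq h)) c

variable {G} in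
theorem clsOrder_ne_one {c : CyclicClass G} (hc : c ≠ cls 1) : clsOrder c ≠ orderOne G := by
  induction c using Quotient.inductionOn with
  | h x =>
    intro h
    apply hc
    have h1 : orderOf x = 1 := congrArg Subtype.val h
    rw [orderOf_eq_one_iff] at h1
    subst h1
    rfl

variable {G} in
/-- The map `[x] ↦ o(x)` from the vertices of the proper quotient power graph to those of the
proper order graph. -/
noncomputable def orderMap (c : {c : CyclicClass G // c ≠ cls 1}) : {m : orderSet G // m ≠ orderOne G} :=
  ⟨clsOrder c.1, clsOrder_ne_one c.2⟩

end Groups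

/-! ### Partitions, types of permutations, power type graph -/

section Types

variable {n : ℕ}

/-- The power `T ^ a` of a partition: each term `x` is replaced by `gcd a x` terms equal to
`x / gcd a x`. -/
def partitionPow (T : n.Partition) (a : ℕ) : n.Partition where
  parts := T.parts.bind (fun x => Multiset.replicate (Nat.gcd a x) (x / Nat.gcd a x))
  parts_pos := by
    intro i hi
    obtain ⟨x, hx, hi⟩ := Multiset.mem_bind.1 hi
    have hx0 : 0 < x := T.parts_pos hx
    rw [Multiset.eq_of_mem_replicate hi]
    exact Nat.div_pos (Nat.le_of_dvd hx0 (Nat.gcd_dvd_right a x))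
      (Nat.gcd_pos_of_pos_right a hx0)
  parts_sum := by
    rw [Multiset.sum_bind]
    have h : ∀ x ∈ T.parts,
        (Multiset.replicate (Nat.gcd a x) (x / Nat.gcd a x)).sum = id x := by
      intro x _
      rw [Multiset.sum_replicate, smul_eq_mul]
      exact Nat.mul_div_cancel' (Nat.gcd_dvd_right a x)
    rw [Multiset.map_congr rfl h, Multiset.map_id, T.parts_sum]

/-- The order of a partition is the least common multiple of its terms. -/
def partitionOrder (T : n.Partition) : ℕ := T.parts.lcm

/-- The trivial partition `[1 ^ n]`. -/
def trivialPartition (n : ℕ) : n.Partition where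
  parts := Multiset.replicate n 1
  parts_pos := by
    intro i hi
    rw [Multiset.eq_of_mem_replicate hi]
    exact Nat.one_pos
  parts_sum := by simp

/-- The type of a permutation: the partition of `n` given by the sizes of its orbits. -/
def permType (ψ : Equiv.Perm (Fin n)) : n.Partition where
  parts := ψ.partition.parts
  parts_pos := ψ.partition.parts_pos
  parts_sum := ψ.partition.parts_sum.trans (Fintype.card_fin n)

theorem permType_one : permType (1 : Equiv.Perm (Fin n)) = trivialPartition n := by
  apply Nat.Partition.ext
  simp [permType, trivialPartition, Equiv.Perm.parts_partition]

theorem eq_one_of_permType_eq {ψ : Equiv.Perm (Fin n)} (h : permType ψ = trivialPartition n) :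
    ψ = 1 := by
  have h1 : ψ.partition.parts = Multiset.replicate n 1 := congrArg Nat.Partition.parts h
  rw [← Equiv.Perm.cycleType_eq_zero, ← Equiv.Perm.filter_parts_partition_eq_cycleType, h1,
    Multiset.filter_eq_nil]
  intro a ha
  rw [Multiset.eq_of_mem_replicate ha]
  norm_num

theorem cycleType_pow_of_coprime (σ : Equiv.Perm (Fin n)) (k : ℕ) (hk : k.Coprime (orderOf σ)) :
    (σ ^ k).cycleType = σ.cycleType := by
  induction σ using Equiv.Perm.cycle_induction_on with
  | base_one => simp
  | base_cycles σ hσ =>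
    rw [(hσ.pow_iff.2 hk).cycleType, hσ.cycleType, Equiv.Perm.support_pow_coprime hk]
  | induction_disjoint σ τ hd _ hσ hτ =>
    have ho := hd.orderOf
    rw [hd.commute.mul_pow, (hd.pow_disjoint_pow k k).cycleType_mul, hd.cycleType_mul,
      hσ (hk.coprime_dvd_right (ho ▸ Nat.dvd_lcm_left _ _)),
      hτ (hk.coprime_dvd_right (ho ▸ Nat.dvd_lcm_right _ _))]

theorem permType_eq_of_zpowers_eq {x y : Equiv.Perm (Fin n)}
    (h : Subgroup.zpowers x = Subgroup.zpowers y) : permType x = permType y := by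
  have ho := orderOf_eq_of_zpowers_eq h
  have hy : y ∈ Subgroup.zpowers x := h ▸ Subgroup.mem_zpowers y
  obtain ⟨k, rfl⟩ := mem_powers_iff_mem_zpowers.2 hy
  have hk : k.Coprime (orderOf x) := by
    have hx := orderOf_pos x
    simp only [orderOf_pow] at ho
    have h1 := Nat.div_mul_cancel (Nat.gcd_dvd_left (orderOf x) k)
    rw [← ho] at h1
    rw [Nat.coprime_comm]
    exact Nat.eq_of_mul_eq_mul_left hx (by rw [h1, mul_one])
  have hc := cycleType_pow_of_coprime x k hk
  apply Nat.Partition.ext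
  have := (Equiv.Perm.partition_eq_of_isConj.1 (Equiv.Perm.isConj_of_cycleType_eq hc))
  exact (congrArg Nat.Partition.parts this).symm

variable (G : Subgroup (Equiv.Perm (Fin n)))

/-- The set of the types of the elements of `G`. -/
def typeSet : Set n.Partition := Set.range (fun ψ : G => permType ψ.1)

/-- The power type graph of `G`. -/
def powerTypeGraph : SimpleGraph (typeSet G) where
  Adj S T := S ≠ T ∧ ∃ a : ℕ, S.1 = partitionPow T.1 a ∨ T.1 = partitionPow S.1 a
  symm := ⟨fun _ _ ⟨hne, a, h⟩ => ⟨hne.symm, a, h.symm⟩⟩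
  loopless := ⟨fun _ h => h.1 rfl⟩

/-- `[1 ^ n]` as a vertex of the power type graph. -/
def typeOne : typeSet G := ⟨trivialPartition n, 1, permType_one⟩

/-- The proper power type graph of `G`. -/
def properPowerTypeGraph : SimpleGraph {T : typeSet G // T ≠ typeOne G} :=
  deleteVertex (powerTypeGraph G) (typeOne G)

variable {G}

/-- The type of `[ψ]` is the type of `ψ`. -/
def clsType (c : CyclicClass G) : typeSet G :=
  Quotient.lift (s := cyclicSetoid G) (fun ψ : G => (⟨permType ψ.1, ψ, rfl⟩ : typeSet G))
    (fun x y h => Subtype.ext (permType_eq_of_zpowers_eq (by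
      have h1 : Subgroup.zpowers x = Subgroup.zpowers y := h
      have h2 := congrArg (Subgroup.map G.subtype) h1
      rwa [MonoidHom.map_zpowers, MonoidHom.map_zpowers] at h2))) c

theorem clsType_ne_one {c : CyclicClass G} (hc : c ≠ cls 1) : clsType c ≠ typeOne G := by
  induction c using Quotient.inductionOn with
  | h ψ =>
    intro h
    apply hc
    have h1 : ψ.1 = 1 := eq_one_of_permType_eq (congrArg Subtype.val h)
    have h2 : ψ = 1 := Subtype.ext h1
    subst h2
    rfl

/-- The map `[ψ] ↦ T_ψ` from the vertices of the proper quotient power graph to those of the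
proper power type graph. -/
def typeMap (c : {c : CyclicClass G // c ≠ cls 1}) : {T : typeSet G // T ≠ typeOne G} :=
  ⟨clsType c.1, clsType_ne_one c.2⟩

end Types

/-! ### The main component and the set of critical degrees -/

/-- The permutation `(12)(34)` as an element of `A_n`; the set `{1, …, n}` is represented by
`Fin n = {0, …, n - 1}`. -/
def doubleTransposition (n : ℕ) (hn : 4 ≤ n) : alternatingGroup (Fin n) :=
  ⟨Equiv.swap ⟨0, by omega⟩ ⟨1, by omega⟩ * Equiv.swap ⟨2, by omega⟩ ⟨3, by omega⟩, by
    have h1 : (⟨0, by omega⟩ : Fin n) ≠ ⟨1, by omega⟩ := by simp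
    have h2 : (⟨2, by omega⟩ : Fin n) ≠ ⟨3, by omega⟩ := by simp
    rw [Equiv.Perm.mem_alternatingGroup, Equiv.Perm.sign_mul, Equiv.Perm.sign_swap h1,
      Equiv.Perm.sign_swap h2]
    rfl⟩

theorem doubleTransposition_ne_one (n : ℕ) (hn : 4 ≤ n) : doubleTransposition n hn ≠ 1 := by
  intro h
  have h1 := congrArg (fun g : alternatingGroup (Fin n) => g.1 ⟨0, by omega⟩) h
  have h2 : (Equiv.swap (⟨2, by omega⟩ : Fin n) ⟨3, by omega⟩) ⟨0, by omega⟩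
      = (⟨0, by omega⟩ : Fin n) := Equiv.swap_apply_of_ne_of_ne (by simp) (by simp)
  simp [doubleTransposition, h2] at h1

/-- The component of the proper quotient power graph of `A_n` containing `[(12)(34)]`. -/
def mainComponent (n : ℕ) (hn : 4 ≤ n) :
    (properQuotientPowerGraph (alternatingGroup (Fin n))).ConnectedComponent :=
  (properQuotientPowerGraph (alternatingGroup (Fin n))).connectedComponentMk
    (properCls ⟨doubleTransposition n hn, doubleTransposition_ne_one n hn⟩)

/-- The set `bP + c`, where `P` is the set of prime numbers. -/
def primeTranslate (b c : ℕ) : Set ℕ := {x : ℕ | ∃ p : ℕ, p.Prime ∧ x = b * p + c}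

/-- The set `A = P ∪ (P+1) ∪ (P+2) ∪ 2P ∪ (2P+1)`. -/
def setA : Set ℕ :=
  primeTranslate 1 0 ∪ primeTranslate 1 1 ∪ primeTranslate 1 2 ∪ primeTranslate 2 0 ∪
    primeTranslate 2 1

end AltPowerGraphs

open AltPowerGraphs

/-! Call an even permutation critical if, for some prime `p`, it is a `p`-cycle with at most two
fixed points or a product of two disjoint `p`-cycles with at most one fixed point. The main
component of the quotient power graph consists exactly of the noncritical classes, and every
critical class is isolated (`properCls_mem_mainComponent_iff`, `not_adj_of_isCritical`).

Critical classes are isolated because an even `φ` with a critical power has order `p` itself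
(`orderOf_eq_of_pow_critical`). The cycles of `φ` that survive in the power have lengths divisible
by `p` and cover `p` or `2p` points, and too few points remain for anything else but one
transposition. Parity excludes the types `{p, 2}` and `{2p}`.

Noncritical elements hang together because commuting elements of coprime orders are powers of their
product, hence linked. Any noncritical element has a noncritical power of prime order, and such a
power is led to a double transposition (`linkedToDouble_of_prime_orderOf`): either a 3-cycle or
double transposition fits into its fixed points, or an element of order 2 or 3 permutes its equally
long cycles (`exists_commute_permuting_cycles`). Two double transpositions move at most 8 points, so
for `n ≥ 11` both commute with a common disjoint 3-cycle.

Membership in `A` is what makes critical elements exist, and congruences modulo 2 and 3 leave at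
most two critical primes (`encard_criticalPrimes_le`). The other graphs inherit the picture. Mutual
powers are adjacent in the power graph, and edges between types or orders lift to edges between
classes. Criticality depends only on the type. It does not depend only on the order, so the order
graph may have no further component. Orders 2 and 3 both occur in each main component, which
prevents completeness. -/

namespace AltPowerGraphs

/-! ### Images of components and isolated vertices -/

section GraphLemmas

variable {V W : Type*}

/-- A walk in `Y` starting at `f v` lifts edge by edge, so it never leaves the image of the
component. The lifted edge may start at another preimage `x'` of `f x`, as long as `x'` lies in the
same component. -/
theorem isImageOfComponent_of_lift {X : SimpleGraph V} {Y : SimpleGraph W} {f : V → W}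
    (v : V)
    (hmap : ∀ x y, X.Adj x y → f x ≠ f y → Y.Adj (f x) (f y))
    (hlift : ∀ x ∈ (X.connectedComponentMk v).supp, ∀ b, Y.Adj (f x) b →
      ∃ x' ∈ (X.connectedComponentMk v).supp, ∃ y ∈ (X.connectedComponentMk v).supp,
        X.Adj x' y ∧ f x' = f x ∧ f y = b) :
    IsImageOfComponent X Y f (X.connectedComponentMk v) (Y.connectedComponentMk (f v)) := by
  have hreach : ∀ x y, X.Reachable x y → Y.Reachable (f x) (f y) := by
    rintro x y ⟨w⟩
    induction w with
    | nil => rfl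
    | @cons a b c h _ ih =>
      by_cases hab : f a = f b
      · rw [hab]; exact ih
      · exact (hmap a b h hab).reachable.trans ih
  have himage : f '' (X.connectedComponentMk v).supp = (Y.connectedComponentMk (f v)).supp := by
    ext b
    constructor
    · rintro ⟨x, hx, rfl⟩
      rw [SimpleGraph.ConnectedComponent.mem_supp_iff, SimpleGraph.ConnectedComponent.eq] at hx ⊢
      exact hreach x v hx
    · intro hb
      rw [SimpleGraph.ConnectedComponent.mem_supp_iff, SimpleGraph.ConnectedComponent.eq] at hb
      have key : ∀ a b, Y.Walk a b → a ∈ f '' (X.connectedComponentMk v).supp →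
          b ∈ f '' (X.connectedComponentMk v).supp := by
        intro a b w
        induction w with
        | nil => exact id
        | cons h _ ih =>
          rintro ⟨x, hx, rfl⟩
          obtain ⟨_, _, y, hy, _, _, hfy⟩ := hlift x hx _ h
          exact ih ⟨y, hy, hfy⟩
      obtain ⟨w⟩ := hb.symm
      exact key _ _ w ⟨v, rfl, rfl⟩
  refine ⟨himage, fun a ha b _ => ⟨fun hab => ⟨hab.ne, ?_⟩, ?_⟩⟩
  · rw [← himage] at ha
    obtain ⟨x, hx, rfl⟩ := ha
    obtain ⟨x', hx', y, hy, h, hfx, hfy⟩ := hlift x hx b hab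
    exact ⟨x', hx', y, hy, h, hfx, hfy⟩
  · rintro ⟨hne, x, _, y, _, h, rfl, rfl⟩
    exact hmap x y h hne

theorem eq_of_reachable_of_isolated {X : SimpleGraph V} {v w : V} (hv : ∀ u, ¬ X.Adj v u)
    (h : X.Reachable v w) : w = v := by
  obtain ⟨p⟩ := h
  cases p with
  | nil => rfl
  | cons h _ => exact absurd h (hv _)

theorem supp_eq_singleton_of_isolated {X : SimpleGraph V} {v : V} (hv : ∀ u, ¬ X.Adj v u) :
    (X.connectedComponentMk v).supp = {v} := by
  ext w
  rw [SimpleGraph.ConnectedComponent.mem_supp_iff, SimpleGraph.ConnectedComponent.eq,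
    Set.mem_singleton_iff]
  exact ⟨fun h => eq_of_reachable_of_isolated hv h.symm, fun h => h ▸ .rfl⟩

end GraphLemmas

/-! ### Linking elements through powers -/

section GroupLemmas

variable {G : Type*} [Group G]

theorem properCls_eq_iff {x y : {x : G // x ≠ 1}} :
    properCls x = properCls y ↔ Subgroup.zpowers x.1 = Subgroup.zpowers y.1 := by
  rw [← cls_eq_iff]
  exact Subtype.ext_iff

theorem properCls_surjective : Function.Surjective (properCls (G := G)) := by
  rintro ⟨c, hc⟩
  induction c using Quotient.inductionOn with
  | h x => exact ⟨⟨x, fun h => hc (by subst h; rfl)⟩, rfl⟩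

theorem properQuotientPowerGraph_adj_of_pow {x y : {x : G // x ≠ 1}} {m : ℕ}
    (h : y.1 = x.1 ^ m) (hne : properCls x ≠ properCls y) :
    (properQuotientPowerGraph G).Adj (properCls x) (properCls y) := by
  refine ⟨fun h' => hne (Subtype.ext h'), x.1, y.1, rfl, rfl, ?_, m, Or.inr h⟩
  rintro h'
  exact hne (congrArg properCls (Subtype.ext h'))

theorem exists_of_properQuotientPowerGraph_adj {a b : {c : CyclicClass G // c ≠ cls 1}}
    (h : (properQuotientPowerGraph G).Adj a b) :
    ∃ x y : {x : G // x ≠ 1}, properCls x = a ∧ properCls y = b ∧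
      (properPowerGraph G).Adj x y := by
  obtain ⟨_, x, y, hx, hy, hadj⟩ := h
  refine ⟨⟨x, ?_⟩, ⟨y, ?_⟩, Subtype.ext hx, Subtype.ext hy, hadj⟩
  · rintro rfl; exact a.2 hx.symm
  · rintro rfl; exact b.2 hy.symm

variable (G) in
/-- Two elements are linked when their classes lie in the same component. -/
def Linked (x y : {x : G // x ≠ 1}) : Prop :=
  (properQuotientPowerGraph G).Reachable (properCls x) (properCls y)

theorem Linked.symm {x y : {x : G // x ≠ 1}} (h : Linked G x y) : Linked G y x :=
  SimpleGraph.Reachable.symm h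

theorem Linked.trans {x y z : {x : G // x ≠ 1}} (h : Linked G x y) (h' : Linked G y z) :
    Linked G x z :=
  SimpleGraph.Reachable.trans h h'

theorem linked_of_pow {x y : {x : G // x ≠ 1}} {m : ℕ} (h : y.1 = x.1 ^ m) : Linked G x y := by
  by_cases hne : properCls x = properCls y
  · unfold Linked; rw [hne]
  · exact (properQuotientPowerGraph_adj_of_pow h hne).reachable

/-- Both elements are powers of their product, with exponents from the Chinese remainder theorem:
`a` is 1 modulo `orderOf x.1` and 0 modulo `orderOf y.1`, and `b` the reverse. -/
theorem linked_of_commute_of_coprime {x y : {x : G // x ≠ 1}} (h : Commute x.1 y.1)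
    (hc : (orderOf x.1).Coprime (orderOf y.1)) : Linked G x y := by
  obtain ⟨a, ha1, ha2⟩ := Nat.chineseRemainder hc 1 0
  obtain ⟨b, hb1, hb2⟩ := Nat.chineseRemainder hc 0 1
  have hx : x.1 = (x.1 * y.1) ^ a := by
    rw [h.mul_pow, pow_eq_pow_iff_modEq.2 ha1, pow_eq_pow_iff_modEq.2 ha2]; simp
  have hy : y.1 = (x.1 * y.1) ^ b := by
    rw [h.mul_pow, pow_eq_pow_iff_modEq.2 hb1, pow_eq_pow_iff_modEq.2 hb2]; simp
  have hne : x.1 * y.1 ≠ 1 := by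
    intro h1; rw [h1, one_pow] at hx; exact x.2 hx
  exact (linked_of_pow (x := ⟨_, hne⟩) hx).symm.trans (linked_of_pow (x := ⟨_, hne⟩) hy)

variable [Finite G]

theorem exists_pow_eq_of_zpowers_eq {x y : G} (h : Subgroup.zpowers x = Subgroup.zpowers y) :
    ∃ m : ℕ, y = x ^ m := by
  have hy : y ∈ Subgroup.zpowers x := h ▸ Subgroup.mem_zpowers y
  obtain ⟨k, hk⟩ := mem_powers_iff_mem_zpowers.2 hy
  exact ⟨k, hk.symm⟩

/-- Generators of the same cyclic subgroup are powers of one another, hence equal or adjacent. A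
walk between classes therefore lifts by inserting a step inside each class. -/
theorem properPowerGraph_reachable_iff {x y : {x : G // x ≠ 1}} :
    (properPowerGraph G).Reachable x y ↔
      (properQuotientPowerGraph G).Reachable (properCls x) (properCls y) := by
  constructor
  · rintro ⟨w⟩
    induction w with
    | nil => rfl
    | @cons a b c h _ ih =>
      by_cases hab : properCls a = properCls b
      · rw [hab]; exact ih
      · obtain ⟨_, m, hm | hm⟩ := h
        · exact (properQuotientPowerGraph_adj_of_pow hm (Ne.symm hab)).symm.reachable.trans ih
        · exact (properQuotientPowerGraph_adj_of_pow hm hab).reachable.trans ih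
  · have hcls : ∀ x y : {x : G // x ≠ 1}, properCls x = properCls y →
        (properPowerGraph G).Reachable x y := by
      intro x y h
      by_cases hxy : x = y
      · rw [hxy]
      · obtain ⟨m, hm⟩ := exists_pow_eq_of_zpowers_eq (properCls_eq_iff.1 h)
        exact SimpleGraph.Adj.reachable ⟨fun h' => hxy (Subtype.ext h'), m, Or.inr hm⟩
    have key : ∀ a b, (properQuotientPowerGraph G).Walk a b → ∀ x y : {x : G // x ≠ 1},
        properCls x = a → properCls y = b → (properPowerGraph G).Reachable x y := by
      intro a b w
      induction w with
      | nil => intro x y hx hy; exact hcls x y (hx.trans hy.symm)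
      | cons h _ ih =>
        intro x y hx hy
        obtain ⟨x', z, hx', hz, hadj⟩ := exists_of_properQuotientPowerGraph_adj h
        exact ((hcls x x' (hx.trans hx'.symm)).trans hadj.reachable).trans (ih z y hz hy)
    rintro ⟨w⟩
    exact key _ _ w x y rfl rfl

end GroupLemmas

/-! ### Cycle types of powers -/

section CycleType

open Equiv Equiv.Perm

variable {α : Type*} [Fintype α] [DecidableEq α]

/-- All cycles of the power have the same length, the order of `σ ^ a`, and together they cover the
support of `σ`; this determines their number. -/
theorem cycleType_pow_of_isCycle {σ : Perm α} (hσ : σ.IsCycle) {a : ℕ}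
    (h : ¬ σ.support.card ∣ a) :
    (σ ^ a).cycleType = Multiset.replicate (Nat.gcd a σ.support.card)
      (σ.support.card / Nat.gcd a σ.support.card) := by
  have hord := hσ.orderOf
  have hpos : 0 < σ.support.card := hord ▸ orderOf_pos σ
  set l := σ.support.card with hl
  have hordpow : orderOf (σ ^ a) = l / Nat.gcd a l := by
    rw [orderOf_pow, hord, Nat.gcd_comm]
  have hall : ∀ m ∈ (σ ^ a).cycleType, m = l / Nat.gcd a l := by
    intro m hm
    apply Nat.dvd_antisymm
    · rw [← hordpow]; exact dvd_of_mem_cycleType hm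
    · rw [cycleType_def, Multiset.mem_map] at hm
      obtain ⟨c, hc, rfl⟩ := hm
      rw [Finset.mem_val, mem_cycleFactorsFinset_iff] at hc
      obtain ⟨x, hx⟩ := hc.1.nonempty_support
      have hσx : σ x ≠ x := by
        have h1 : (σ ^ a) x ≠ x := by
          rw [← hc.2 x hx]; exact mem_support.1 hx
        intro h2
        exact h1 (pow_apply_eq_self_of_apply_eq_self h2 a)
      -- A cycle factor `c` agrees with `σ ^ a` on its own support. So `σ ^ a` raised to the length
      -- of `c` fixes a point moved by `σ`, and a power of a cycle with that property is trivial.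
      have hcpow : ∀ k : ℕ, (c ^ k) x = ((σ ^ a) ^ k) x ∧ (c ^ k) x ∈ c.support := by
        intro k
        induction k with
        | zero => exact ⟨rfl, hx⟩
        | succ k ih =>
          rw [pow_succ', pow_succ', mul_apply, mul_apply, ← ih.1, hc.2 _ ih.2]
          refine ⟨rfl, ?_⟩
          rw [← hc.2 _ ih.2]
          exact apply_mem_support.2 ih.2
      have h1 : ((σ ^ a) ^ (c.support.card)) x = x := by
        rw [← (hcpow _).1]
        rw [← hc.1.orderOf, pow_orderOf_eq_one, one_apply]
      rw [← hordpow, orderOf_dvd_iff_pow_eq_one, ← pow_mul]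
      rw [← pow_mul] at h1
      exact hσ.pow_eq_one_iff.2 ⟨x, hσx, h1⟩
  have hrep := Multiset.eq_replicate_card.2 hall
  have hsum : (σ ^ a).cycleType.sum = l := by
    rw [sum_cycleType, hl, hσ.support_pow_eq_iff.2 (by rwa [hord])]
  rw [hrep, Multiset.sum_replicate, smul_eq_mul] at hsum
  have hg : Nat.gcd a l * (l / Nat.gcd a l) = l := Nat.mul_div_cancel' (Nat.gcd_dvd_right a l)
  have hq : 0 < l / Nat.gcd a l := by
    rw [← hordpow]; exact orderOf_pos _
  rw [hrep, Nat.eq_of_mul_eq_mul_right hq (hsum.trans hg.symm)]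

theorem cycleType_pow (σ : Perm α) (a : ℕ) :
    (σ ^ a).cycleType = (σ.cycleType.filter (fun x => ¬ x ∣ a)).bind
      (fun x => Multiset.replicate (Nat.gcd a x) (x / Nat.gcd a x)) := by
  induction σ using Equiv.Perm.cycle_induction_on with
  | base_one => simp
  | base_cycles σ hσ =>
    rw [hσ.cycleType]
    by_cases h : σ.support.card ∣ a
    · have h1 : σ ^ a = 1 := by rwa [← orderOf_dvd_iff_pow_eq_one, hσ.orderOf]
      simp [h1, Multiset.filter_singleton, h]
    · rw [cycleType_pow_of_isCycle hσ h]
      simp [Multiset.filter_singleton, h]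
  | induction_disjoint σ τ hd _ hσ hτ =>
    rw [hd.commute.mul_pow, (hd.pow_disjoint_pow a a).cycleType_mul, hd.cycleType_mul, hσ, hτ,
      Multiset.filter_add, Multiset.add_bind]

theorem card_support_pow (σ : Perm α) (a : ℕ) :
    (σ ^ a).support.card = (σ.cycleType.filter (fun x => ¬ x ∣ a)).sum := by
  rw [← sum_cycleType, cycleType_pow, Multiset.sum_bind]
  congr 1
  conv_rhs => rw [← Multiset.map_id (Multiset.filter _ _)]
  refine Multiset.map_congr rfl fun x _ => ?_
  rw [Multiset.sum_replicate, smul_eq_mul]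
  exact Nat.mul_div_cancel' (Nat.gcd_dvd_right a x)

theorem permType_parts {n : ℕ} (σ : Perm (Fin n)) :
    (permType σ).parts = σ.cycleType + Multiset.replicate (n - σ.support.card) 1 := by
  change σ.partition.parts = _
  rw [parts_partition, Fintype.card_fin]

theorem permType_eq_iff {n : ℕ} {σ τ : Perm (Fin n)} :
    permType σ = permType τ ↔ σ.cycleType = τ.cycleType := by
  constructor
  · intro h
    have h1 : σ.partition.parts = τ.partition.parts :=
      (congrArg Nat.Partition.parts h : (permType σ).parts = (permType τ).parts)
    rw [← filter_parts_partition_eq_cycleType, ← filter_parts_partition_eq_cycleType, h1]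
  · intro h
    apply Nat.Partition.ext
    rw [permType_parts, permType_parts, ← sum_cycleType, ← sum_cycleType, h]

/-- Cycles whose length does not divide `a` produce the cycle type of `σ ^ a`; the remaining cycles
and the fixed points produce only ones. The number of ones need not be computed, since both
partitions have sum `n`. -/
theorem permType_pow {n : ℕ} (σ : Perm (Fin n)) (a : ℕ) :
    permType (σ ^ a) = partitionPow (permType σ) a := by
  apply Nat.Partition.ext
  have hone : ∃ r, (partitionPow (permType σ) a).parts
      = (σ ^ a).cycleType + Multiset.replicate r 1 := by
    change ∃ r, (permType σ).parts.bind _ = _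
    rw [permType_parts, Multiset.add_bind, cycleType_pow]
    conv in (σ.cycleType.bind _) =>
      rw [← Multiset.filter_add_not (fun x => ¬ x ∣ a) σ.cycleType]
    rw [Multiset.add_bind, add_assoc]
    refine ⟨_, congrArg _ (Multiset.eq_replicate_card.2 ?_)⟩
    intro b hb
    rw [Multiset.mem_add, Multiset.mem_bind, Multiset.mem_bind] at hb
    obtain ⟨x, hx, hb⟩ | ⟨x, hx, hb⟩ := hb
    · rw [Multiset.eq_of_mem_replicate hb]
      obtain ⟨hx1, hx2⟩ := Multiset.mem_filter.1 hx
      rw [not_not] at hx2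
      rw [Nat.gcd_eq_right hx2]
      exact Nat.div_self (by have := two_le_of_mem_cycleType hx1; omega)
    · rw [Multiset.eq_of_mem_replicate hx] at hb
      simpa using hb
  obtain ⟨r, hr⟩ := hone
  have hsum := (partitionPow (permType σ) a).parts_sum
  rw [hr, Multiset.sum_add, sum_cycleType, Multiset.sum_replicate, smul_eq_mul, mul_one] at hsum
  rw [permType_parts, hr]
  congr 2
  omega

theorem partitionOrder_permType {n : ℕ} (σ : Perm (Fin n)) :
    partitionOrder (permType σ) = orderOf σ := by
  rw [partitionOrder, permType_parts, Multiset.lcm_add, lcm_cycleType]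
  have : ∀ r : ℕ, (Multiset.replicate r 1).lcm ∣ 1 := by
    intro r
    rw [Multiset.lcm_dvd]
    intro b hb
    rw [Multiset.eq_of_mem_replicate hb]
  rw [Nat.dvd_one.1 (this _)]
  simp

end CycleType

/-! ### Permutations with prescribed cycle type that commute with a given one -/

section Constructions

open Equiv Equiv.Perm

variable {α : Type*} [Fintype α] [DecidableEq α]

theorem exists_cycleType_eq_disjoint (s : Finset α) (m : Multiset ℕ) (hm : ∀ a ∈ m, 2 ≤ a)
    (hs : m.sum + s.card ≤ Fintype.card α) :
    ∃ τ : Perm α, τ.cycleType = m ∧ _root_.Disjoint τ.support s := by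
  have hcard : Fintype.card {x // x ∉ s} = Fintype.card α - s.card := by
    rw [Fintype.card_subtype_compl, Fintype.card_coe]
  obtain ⟨g, hg⟩ := (exists_with_cycleType_iff {x // x ∉ s} (m := m)).2
    ⟨by rw [hcard]; omega, hm⟩
  refine ⟨ofSubtype g, by rw [cycleType_ofSubtype, hg], ?_⟩
  rw [support_ofSubtype, Finset.disjoint_left]
  intro x hx
  obtain ⟨y, _, rfl⟩ := Finset.mem_map.1 hx
  exact y.2

/-- Since all cycles of `σ` have the same length, any permutation of the set of cycles is induced by
an element of the centralizer. A base point in each cycle makes the choice a homomorphism, which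
transfers `t ^ m.lcm = 1`; each moved cycle contributes its `p` points to the support. -/
theorem exists_commute_permuting_cycles {σ : Perm α} {k p : ℕ}
    (hσ : σ.cycleType = Multiset.replicate k p) {m : Multiset ℕ} (hm : ∀ a ∈ m, 2 ≤ a)
    (hk : m.sum ≤ k) :
    ∃ t : Perm α, Commute σ t ∧ t.support.card = m.sum * p ∧ t.support ⊆ σ.support ∧
      t ^ m.lcm = 1 := by
  have hsupp : ∀ c : σ.cycleFactorsFinset, c.val.support.card = p := by
    intro c
    apply Multiset.eq_of_mem_replicate (n := k)
    rw [← hσ, cycleType_def]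
    exact Multiset.mem_map_of_mem _ c.2
  have hcard : Fintype.card σ.cycleFactorsFinset = k := by
    rw [Fintype.card_coe]
    have := congrArg Multiset.card hσ
    rwa [Multiset.card_replicate, cycleType_def, Multiset.card_map] at this
  obtain ⟨τ, hτ⟩ := (exists_with_cycleType_iff σ.cycleFactorsFinset (m := m)).2
    ⟨by rw [hcard]; exact hk, hm⟩
  obtain ⟨a⟩ := Basis.nonempty σ
  have hmem : τ ∈ OnCycleFactors.range_toPermHom' σ :=
    OnCycleFactors.mem_range_toPermHom'_iff.2 fun c => by rw [hsupp, hsupp]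
  refine ⟨a.ofPermHom ⟨τ, hmem⟩, ?_, ?_, ?_, ?_⟩
  · exact (Subgroup.mem_centralizer_singleton_iff.1 (a.ofPermHom_mem_centralizer ⟨τ, hmem⟩)).symm
  · rw [a.card_ofPermHom_support, Finset.sum_congr rfl fun c _ => hsupp c, Finset.sum_const,
      ← sum_cycleType, hτ, smul_eq_mul]
  · rw [a.ofPermHom_support]
    intro x hx
    obtain ⟨c, _, hc⟩ := Finset.mem_biUnion.1 hx
    exact mem_cycleFactorsFinset_support_le c.2 hc
  · have : (⟨τ, hmem⟩ : OnCycleFactors.range_toPermHom' σ) ^ m.lcm = 1 := by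
      apply Subtype.ext
      rw [SubmonoidClass.coe_pow, OneMemClass.coe_one, ← hτ, lcm_cycleType, pow_orderOf_eq_one]
    rw [← map_pow, this, map_one]

theorem sign_of_sq_eq_one {σ : Perm α} (h : σ ^ 2 = 1) {k : ℕ} (hk : σ.support.card = 2 * k) :
    sign σ = (-1) ^ k := by
  have h1 := cycleType_of_pow_prime_eq_one h
  have h2 : σ.cycleType.card = k := by
    have := σ.sum_cycleType
    rw [h1, Multiset.sum_replicate, smul_eq_mul] at this
    omega
  rw [sign_of_cycleType, sum_cycleType, hk, h2, pow_add, pow_mul]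
  simp

theorem sign_of_odd_pow_eq_one {σ : Perm α} {m : ℕ} (hm : Odd m) (h : σ ^ m = 1) :
    sign σ = 1 := by
  have h1 : sign σ ^ m = 1 := by rw [← map_pow, h, map_one]
  obtain h2 | h2 := Int.units_eq_one_or (sign σ)
  · exact h2
  · rw [h2, hm.neg_one_pow] at h1
    exact absurd h1 (by decide)

theorem ne_one_of_card_support {σ : Perm α} (h : 0 < σ.support.card) : σ ≠ 1 := by
  rintro rfl
  simp at h

end Constructions

/-! ### Linking noncritical elements of prime order to a double transposition -/

section Linking

open Equiv Equiv.Perm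

variable {n : ℕ}

/-- Two even permutations of `Fin n` are linked when they are nontrivial and their classes lie in
the same component of the proper quotient power graph of the alternating group. -/
def AltLinked (σ τ : Perm (Fin n)) : Prop :=
  ∃ x y : {x : alternatingGroup (Fin n) // x ≠ 1}, x.1.1 = σ ∧ y.1.1 = τ ∧ Linked _ x y

theorem AltLinked.symm {σ τ : Perm (Fin n)} : AltLinked σ τ → AltLinked τ σ := by
  rintro ⟨x, y, hx, hy, h⟩
  exact ⟨y, x, hy, hx, h.symm⟩

theorem AltLinked.trans {σ τ ρ : Perm (Fin n)} :
    AltLinked σ τ → AltLinked τ ρ → AltLinked σ ρ := by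
  rintro ⟨x, y, hx, hy, h⟩ ⟨y', z, hy', hz, h'⟩
  obtain rfl : y = y' := Subtype.ext (Subtype.ext (hy.trans hy'.symm))
  exact ⟨x, z, hx, hz, h.trans h'⟩

theorem altLinked_of_pow {σ : Perm (Fin n)} (hσ : sign σ = 1) {m : ℕ} (h : σ ^ m ≠ 1) :
    AltLinked σ (σ ^ m) := by
  have h1 : σ ≠ 1 := by rintro rfl; simp at h
  refine ⟨⟨⟨σ, mem_alternatingGroup.2 hσ⟩, fun h' => h1 (congrArg Subtype.val h')⟩,
    ⟨⟨σ, mem_alternatingGroup.2 hσ⟩ ^ m, fun h' => h (congrArg Subtype.val h')⟩, rfl, rfl,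
    linked_of_pow (m := m) rfl⟩

theorem altLinked_of_commute {σ τ : Perm (Fin n)} (hσ : sign σ = 1) (hτ : sign τ = 1)
    (hσ1 : σ ≠ 1) (hτ1 : τ ≠ 1) (h : Commute σ τ) (hc : (orderOf σ).Coprime (orderOf τ)) :
    AltLinked σ τ := by
  refine ⟨⟨⟨σ, mem_alternatingGroup.2 hσ⟩, fun h' => hσ1 (congrArg Subtype.val h')⟩,
    ⟨⟨τ, mem_alternatingGroup.2 hτ⟩, fun h' => hτ1 (congrArg Subtype.val h')⟩, rfl, rfl,
    linked_of_commute_of_coprime (Subtype.ext h) ?_⟩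
  rwa [← Subgroup.orderOf_coe, ← Subgroup.orderOf_coe]

theorem sign_of_cycleType_eq_two_two {d : Perm (Fin n)} (h : d.cycleType = {2, 2}) :
    sign d = 1 := by
  rw [sign_of_cycleType, h]; decide

theorem orderOf_of_cycleType_eq_two_two {d : Perm (Fin n)} (h : d.cycleType = {2, 2}) :
    orderOf d = 2 := by
  rw [← lcm_cycleType, h]; decide

theorem card_support_of_cycleType_eq_two_two {d : Perm (Fin n)} (h : d.cycleType = {2, 2}) :
    d.support.card = 4 := by
  rw [← sum_cycleType, h]; rfl

theorem ne_one_of_cycleType_eq_two_two {d : Perm (Fin n)} (h : d.cycleType = {2, 2}) : d ≠ 1 :=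
  ne_one_of_card_support (by rw [card_support_of_cycleType_eq_two_two h]; norm_num)

theorem exists_isThreeCycle_disjoint {s : Finset (Fin n)} (hs : s.card + 3 ≤ n) :
    ∃ c : Perm (Fin n), c.IsThreeCycle ∧ _root_.Disjoint c.support s :=
  exists_cycleType_eq_disjoint s {3} (by simp)
    (by rw [Fintype.card_fin, Multiset.sum_singleton]; omega)

theorem altLinked_of_cycleType_eq_two_two (hn : 11 ≤ n) {d d' : Perm (Fin n)}
    (hd : d.cycleType = {2, 2}) (hd' : d'.cycleType = {2, 2}) : AltLinked d d' := by
  -- The two supports cover at most 8 points, which leaves room for a 3-cycle when `n ≥ 11`.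
  obtain ⟨c, hc, hdisj⟩ := exists_isThreeCycle_disjoint (n := n) (s := d.support ∪ d'.support) (by
    have := Finset.card_union_le d.support d'.support
    rw [card_support_of_cycleType_eq_two_two hd, card_support_of_cycleType_eq_two_two hd'] at this
    omega)
  rw [Finset.disjoint_union_right] at hdisj
  have key : ∀ e : Perm (Fin n), e.cycleType = {2, 2} → _root_.Disjoint c.support e.support →
      AltLinked c e := fun e he h =>
    altLinked_of_commute hc.sign (sign_of_cycleType_eq_two_two he) hc.ne_one
      (ne_one_of_cycleType_eq_two_two he)
      (disjoint_iff_disjoint_support.2 h).commute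
      (by rw [hc.orderOf, orderOf_of_cycleType_eq_two_two he]; norm_num)
  exact (key d hd hdisj.1).symm.trans (key d' hd' hdisj.2)

/-- A permutation linked to some double transposition. -/
def LinkedToDouble (σ : Perm (Fin n)) : Prop :=
  ∃ d : Perm (Fin n), d.cycleType = {2, 2} ∧ AltLinked σ d

theorem AltLinked.linkedToDouble {σ τ : Perm (Fin n)} (h : AltLinked σ τ)
    (hτ : LinkedToDouble τ) : LinkedToDouble σ := by
  obtain ⟨d, hd, h'⟩ := hτ
  exact ⟨d, hd, h.trans h'⟩

theorem linkedToDouble_of_odd_orderOf {σ : Perm (Fin n)} (hs : sign σ = 1) (h1 : σ ≠ 1)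
    (ho : Odd (orderOf σ)) (hcard : σ.support.card + 4 ≤ n) : LinkedToDouble σ := by
  obtain ⟨d, hd, hdisj⟩ := exists_cycleType_eq_disjoint σ.support {2, 2} (by simp)
    (by rw [Fintype.card_fin]; change 4 + _ ≤ n; omega)
  refine ⟨d, hd, altLinked_of_commute hs (sign_of_cycleType_eq_two_two hd) h1
    (ne_one_of_cycleType_eq_two_two hd) (disjoint_iff_disjoint_support.2 hdisj).commute.symm ?_⟩
  rw [orderOf_of_cycleType_eq_two_two hd]
  exact Nat.coprime_two_right.2 ho

theorem linkedToDouble_of_coprime_three (hn : 7 ≤ n) {σ : Perm (Fin n)} (hs : sign σ = 1)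
    (h1 : σ ≠ 1) (ho : (orderOf σ).Coprime 3) (hcard : σ.support.card + 3 ≤ n) :
    LinkedToDouble σ := by
  obtain ⟨c, hc, hdisj⟩ := exists_isThreeCycle_disjoint hcard
  refine (altLinked_of_commute hs hc.sign h1 hc.ne_one
    (disjoint_iff_disjoint_support.2 hdisj).commute.symm
    (by rwa [hc.orderOf])).linkedToDouble ?_
  exact linkedToDouble_of_odd_orderOf hc.sign hc.ne_one (by rw [hc.orderOf]; decide)
    (by rw [hc.card_support]; omega)

/-- The element `τ` permutes three of the `p`-cycles of `σ` cyclically. -/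
theorem exists_altLinked_order_three {σ : Perm (Fin n)} (hs : sign σ = 1) {k p : ℕ}
    (hp : p.Coprime 3) (hp1 : 0 < p) (hσ : σ.cycleType = Multiset.replicate k p) (hk : 3 ≤ k) :
    ∃ τ : Perm (Fin n), sign τ = 1 ∧ orderOf τ = 3 ∧ τ.support.card = 3 * p ∧ AltLinked σ τ := by
  obtain ⟨τ, hcomm, hcard, _, hpow⟩ := exists_commute_permuting_cycles hσ (m := {3}) (by simp)
    (by simpa using hk)
  have hτ1 : τ ≠ 1 := ne_one_of_card_support (by rw [hcard]; simpa using hp1)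
  have hpow3 : τ ^ 3 = 1 := by simpa using hpow
  have hord : orderOf τ = 3 := orderOf_eq_prime hpow3 hτ1
  have hsign := sign_of_odd_pow_eq_one (by decide : Odd 3) hpow3
  have hσord : orderOf σ ∣ p := by
    rw [← lcm_cycleType, hσ, Multiset.lcm_dvd]
    intro b hb
    rw [Multiset.eq_of_mem_replicate hb]
  refine ⟨τ, hsign, hord, by simpa using hcard, altLinked_of_commute hs hsign ?_ hτ1 hcomm ?_⟩
  · rintro rfl
    have := congrArg Multiset.card hσ
    simp at this
    omega
  · rw [hord]
    exact hp.coprime_dvd_left hσord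

theorem linkedToDouble_of_orderOf_eq_two (hn : 11 ≤ n) {σ : Perm (Fin n)} (hs : sign σ = 1)
    (ho : orderOf σ = 2) : LinkedToDouble σ := by
  have h1 : σ ≠ 1 := by rintro rfl; simp at ho
  by_cases hcard : σ.support.card + 3 ≤ n
  · exact linkedToDouble_of_coprime_three (by omega) hs h1 (by rw [ho]; norm_num) hcard
  -- Here `σ` consists of `k + 1` transpositions moving at least 9 points, so at least three can be
  -- permuted. The resulting element of order 3 moves 6 points and leaves at least 4 fixed.
  · obtain ⟨k, hk⟩ := cycleType_prime_order (σ := σ) (by rw [ho]; exact Nat.prime_two)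
    rw [ho] at hk
    have hsum := σ.sum_cycleType
    rw [hk, Multiset.sum_replicate, smul_eq_mul] at hsum
    obtain ⟨τ, hτs, hτo, hτc, h⟩ :=
      exists_altLinked_order_three hs (by norm_num) (by norm_num) hk (by omega)
    exact h.linkedToDouble (linkedToDouble_of_odd_orderOf hτs
      (by rintro rfl; simp at hτo) (by rw [hτo]; decide) (by omega))

theorem linkedToDouble_of_commute_involution (hn : 11 ≤ n) {σ t : Perm (Fin n)}
    (hs : sign σ = 1) (h1 : σ ≠ 1) (ho : Odd (orderOf σ)) (hcomm : Commute σ t)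
    (ht : t ^ 2 = 1) (ht1 : t ≠ 1) (hts : sign t = 1) : LinkedToDouble σ := by
  have hto : orderOf t = 2 := orderOf_eq_prime ht ht1
  exact (altLinked_of_commute hs hts h1 ht1 hcomm
    (by rw [hto]; exact Nat.coprime_two_right.2 ho)).linkedToDouble
    (linkedToDouble_of_orderOf_eq_two hn hts hto)

/-- Interchanging two `p`-cycles is a product of `p` transpositions, hence odd. A transposition of
two fixed points of `σ` corrects the sign and keeps the involution in the centralizer. -/
theorem linkedToDouble_of_two_fixed (hn : 11 ≤ n) {σ : Perm (Fin n)}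
    (hs : sign σ = 1) (h1 : σ ≠ 1) {k p : ℕ} (hp : Odd p) (ho : orderOf σ = p)
    (hσ : σ.cycleType = Multiset.replicate k p) (hk : 2 ≤ k)
    (hcard : σ.support.card + 2 ≤ n) : LinkedToDouble σ := by
  obtain ⟨t, hcomm, htc, hts, hpow⟩ := exists_commute_permuting_cycles hσ (m := {2}) (by simp)
    (by simpa using hk)
  obtain ⟨r, hr, hdisj⟩ := exists_cycleType_eq_disjoint σ.support {2} (by simp)
    (by rw [Fintype.card_fin, Multiset.sum_singleton]; omega)
  have hpow2 : t ^ 2 = 1 := by simpa using hpow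
  have hr2 : r ^ 2 = 1 := by
    rw [← orderOf_dvd_iff_pow_eq_one, ← lcm_cycleType, hr]; decide
  have hrs : sign r = -1 := by rw [sign_of_cycleType, hr]; decide
  have hσr : Commute σ r := (disjoint_iff_disjoint_support.2 hdisj).commute.symm
  have htr : Perm.Disjoint t r :=
    disjoint_iff_disjoint_support.2 (hdisj.mono_right hts).symm
  have hsign : sign (t * r) = 1 := by
    rw [Perm.sign_mul, sign_of_sq_eq_one hpow2 (k := p) (by simpa using htc), hrs, hp.neg_one_pow]
    decide
  refine linkedToDouble_of_commute_involution hn hs h1 (by rwa [ho]) (hcomm.mul_right hσr)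
    (by rw [htr.commute.mul_pow, hpow2, hr2, one_mul]) ?_ hsign
  apply ne_one_of_card_support
  rw [htr.card_support_mul, ← sum_cycleType r, hr]
  simp

theorem linkedToDouble_of_orderOf_eq_three (hn : 11 ≤ n) {σ : Perm (Fin n)}
    (ho : orderOf σ = 3) : LinkedToDouble σ := by
  have h1 : σ ≠ 1 := by rintro rfl; simp at ho
  have hs : sign σ = 1 :=
    sign_of_odd_pow_eq_one (by decide : Odd 3) (by rw [← ho, pow_orderOf_eq_one])
  obtain ⟨k, hk⟩ := cycleType_prime_order (σ := σ) (by rw [ho]; exact Nat.prime_three)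
  rw [ho] at hk
  have hsum := σ.sum_cycleType
  rw [hk, Multiset.sum_replicate, smul_eq_mul] at hsum
  -- There are `k + 1` cycles of length 3. A single one leaves room for a double transposition; two
  -- or three move at most 9 points and leave two fixed; from four on, a double transposition of the
  -- cycles is an even involution, made of `2 * 3 = 6` transpositions.
  obtain hk0 | hk1 | hk4 : k = 0 ∨ (1 ≤ k ∧ k ≤ 2) ∨ 3 ≤ k := by omega
  · exact linkedToDouble_of_odd_orderOf hs h1 (by rw [ho]; decide) (by omega)
  · exact linkedToDouble_of_two_fixed hn hs h1 (by decide) ho hk (by omega) (by omega)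
  · obtain ⟨t, hcomm, htc, _, hpow⟩ := exists_commute_permuting_cycles hk (m := {2, 2}) (by simp)
      (by change 4 ≤ _; omega)
    have hpow2 : t ^ 2 = 1 := hpow
    have htc' : t.support.card = 2 * 6 := htc
    exact linkedToDouble_of_commute_involution hn hs h1 (by rw [ho]; decide) hcomm hpow2
      (ne_one_of_card_support (by omega)) (sign_of_sq_eq_one hpow2 htc')

/-- The cycle types, for degree `n`, of a `p`-cycle with at most two fixed points and of a product
of two disjoint `p`-cycles with at most one fixed point. -/
def IsCriticalType (n p : ℕ) (m : Multiset ℕ) : Prop :=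
  m = {p} ∧ n ≤ p + 2 ∨ m = {p, p} ∧ n ≤ 2 * p + 1

/-- A permutation of critical cycle type for some prime. -/
def IsCritical (σ : Perm (Fin n)) : Prop :=
  ∃ p : ℕ, p.Prime ∧ IsCriticalType n p σ.cycleType

theorem linkedToDouble_of_prime_orderOf (hn : 11 ≤ n) {σ : Perm (Fin n)} (hs : sign σ = 1)
    (hp : (orderOf σ).Prime) (hc : ¬ IsCritical σ) : LinkedToDouble σ := by
  have h1 : σ ≠ 1 := by rintro rfl; simp [Nat.not_prime_one] at hp
  obtain ⟨p, ho⟩ : ∃ p, orderOf σ = p := ⟨_, rfl⟩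
  rw [ho] at hp
  obtain rfl | h2 := eq_or_ne p 2
  · exact linkedToDouble_of_orderOf_eq_two hn hs ho
  obtain rfl | h3 := eq_or_ne p 3
  · exact linkedToDouble_of_orderOf_eq_three hn ho
  have hodd : Odd p := hp.odd_of_ne_two h2
  have hcop : p.Coprime 3 := (Nat.coprime_primes hp Nat.prime_three).2 h3
  obtain ⟨k, hk⟩ := cycleType_prime_order (σ := σ) (by rwa [ho])
  rw [ho] at hk
  have hsum := σ.sum_cycleType
  rw [hk, Multiset.sum_replicate, smul_eq_mul] at hsum
  -- The number of cycles is `k + 1`. For one or two cycles, not being critical supplies the fixed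
  -- points needed; three or more can be permuted by an element of order 3.
  obtain rfl | rfl | hk2 : k = 0 ∨ k = 1 ∨ 2 ≤ k := by omega
  · refine linkedToDouble_of_coprime_three (by omega) hs h1 (by rwa [ho]) ?_
    by_contra hcon
    exact hc ⟨p, hp, Or.inl ⟨hk, by omega⟩⟩
  · refine linkedToDouble_of_two_fixed hn hs h1 hodd ho hk le_rfl ?_
    by_contra hcon
    exact hc ⟨p, hp, Or.inr ⟨hk, by omega⟩⟩
  · obtain ⟨τ, _, hτo, _, h⟩ := exists_altLinked_order_three hs hcop hp.pos hk (by omega)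
    exact h.linkedToDouble (linkedToDouble_of_orderOf_eq_three hn hτo)

end Linking

/-! ### Critical cycle types and critical primes -/

section Critical

open Equiv Equiv.Perm

variable {n : ℕ}

theorem multiset_eq_zero_of_sum_le_one {m : Multiset ℕ} (hm : ∀ a ∈ m, 2 ≤ a) (hs : m.sum ≤ 1) :
    m = 0 := by
  refine Multiset.eq_zero_of_forall_notMem fun a ha => ?_
  have := hm a ha
  have := Multiset.single_le_sum (fun _ _ => Nat.zero_le _) a ha
  omega

theorem multiset_cases_of_sum_le_two {m : Multiset ℕ} (hm : ∀ a ∈ m, 2 ≤ a) (hs : m.sum ≤ 2) :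
    m = 0 ∨ m = {2} := by
  obtain rfl | ⟨a, ha⟩ := m.empty_or_exists_mem
  · exact Or.inl rfl
  · right
    obtain ⟨t, rfl⟩ := Multiset.exists_cons_of_mem ha
    have h2 := hm a ha
    rw [Multiset.sum_cons] at hs
    obtain rfl := multiset_eq_zero_of_sum_le_one
      (fun b hb => hm b (Multiset.mem_cons_of_mem hb)) (show t.sum ≤ 1 by omega)
    obtain rfl : a = 2 := by simp at hs; omega
    rfl

theorem multiset_eq_singleton_of_sum_eq {m : Multiset ℕ} {p : ℕ} (hm : ∀ a ∈ m, 2 ≤ a)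
    (hp : 0 < p) (hd : ∀ a ∈ m, p ∣ a) (hs : m.sum = p) : m = {p} := by
  obtain rfl | ⟨a, ha⟩ := m.empty_or_exists_mem
  · simp at hs; omega
  · obtain ⟨t, rfl⟩ := Multiset.exists_cons_of_mem ha
    have h2 := Nat.le_of_dvd (by have := hm a ha; omega) (hd a ha)
    rw [Multiset.sum_cons] at hs
    obtain rfl := multiset_eq_zero_of_sum_le_one
      (fun b hb => hm b (Multiset.mem_cons_of_mem hb)) (show t.sum ≤ 1 by omega)
    obtain rfl : a = p := by simp at hs; omega
    rfl

theorem multiset_cases_of_sum_eq_two_mul {m : Multiset ℕ} {p : ℕ} (hm : ∀ a ∈ m, 2 ≤ a)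
    (hp : 0 < p) (hd : ∀ a ∈ m, p ∣ a) (hs : m.sum = 2 * p) : m = {2 * p} ∨ m = {p, p} := by
  obtain rfl | ⟨a, ha⟩ := m.empty_or_exists_mem
  · simp at hs; omega
  · obtain ⟨t, rfl⟩ := Multiset.exists_cons_of_mem ha
    have ht : ∀ b ∈ t, 2 ≤ b := fun b hb => hm b (Multiset.mem_cons_of_mem hb)
    obtain ⟨c, rfl⟩ := hd a ha
    rw [Multiset.sum_cons] at hs
    have h2 := hm _ ha
    obtain rfl | rfl | rfl | hc : c = 0 ∨ c = 1 ∨ c = 2 ∨ 3 ≤ c := by omega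
    · omega
    · right
      rw [multiset_eq_singleton_of_sum_eq ht hp
        (fun b hb => hd b (Multiset.mem_cons_of_mem hb)) (show t.sum = p by omega), mul_one]
      rfl
    · left
      rw [multiset_eq_zero_of_sum_le_one ht (show t.sum ≤ 1 by omega), mul_comm]
      rfl
    · have := Nat.mul_le_mul_left p hc
      omega

theorem IsCriticalType.orderOf {p : ℕ} {σ : Perm (Fin n)}
    (h : IsCriticalType n p σ.cycleType) : orderOf σ = p := by
  rw [← lcm_cycleType]
  obtain ⟨h, _⟩ | ⟨h, _⟩ := h
  · rw [h]; simp
  · rw [h]; simp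

theorem IsCriticalType.le {p : ℕ} {σ : Perm (Fin n)} (h : IsCriticalType n p σ.cycleType) :
    p ≤ n ∧ n ≤ p + 2 ∨ 2 * p ≤ n ∧ n ≤ 2 * p + 1 := by
  have hle := σ.sum_cycleType_le
  rw [Fintype.card_fin] at hle
  obtain ⟨h, hn⟩ | ⟨h, hn⟩ := h
  · rw [h, Multiset.sum_singleton] at hle
    exact Or.inl ⟨hle, hn⟩
  · rw [h] at hle
    right
    simp at hle
    omega

/-- For a permutation with a critical power, `m₁` plays the part of the cycle lengths that survive
in the power and `m₂` of those that become trivial. Few points remain for `m₂`, and evenness rejects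
`{p, 2}` and `{2 * p}`. -/
theorem multiset_add_eq_of_critical {m₁ m₂ : Multiset ℕ} {p : ℕ} (hp : Odd p)
    (h₁ : ∀ a ∈ m₁, 2 ≤ a) (h₂ : ∀ a ∈ m₂, 2 ≤ a) (hd : ∀ a ∈ m₁, p ∣ a)
    (hle : m₁.sum + m₂.sum ≤ n)
    (hs : (-1 : ℤˣ) ^ ((m₁ + m₂).sum + Multiset.card (m₁ + m₂)) = 1)
    (h : m₁.sum = p ∧ n ≤ p + 2 ∨ m₁.sum = 2 * p ∧ n ≤ 2 * p + 1) :
    m₁ + m₂ = {p} ∨ m₁ + m₂ = {p, p} := by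
  have hs := Nat.even_iff.1 ((neg_one_pow_eq_one_iff_even (by decide)).1 hs)
  have hp2 := Nat.odd_iff.1 hp
  obtain ⟨h, hn⟩ | ⟨h, hn⟩ := h
  · obtain rfl := multiset_eq_singleton_of_sum_eq h₁ hp.pos hd h
    obtain rfl | rfl := multiset_cases_of_sum_le_two h₂ (by omega)
    · exact Or.inl (add_zero _)
    · exfalso
      have : (({p} + {2} : Multiset ℕ).sum + Multiset.card ({p} + {2} : Multiset ℕ)) % 2 = 1 := by
        simp only [Multiset.sum_add, Multiset.sum_singleton, Multiset.card_add,
          Multiset.card_singleton]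
        omega
      omega
  · obtain rfl := multiset_eq_zero_of_sum_le_one h₂ (by omega)
    rw [add_zero] at hs ⊢
    obtain rfl | rfl := multiset_cases_of_sum_eq_two_mul h₁ hp.pos hd h
    · exfalso
      have : (({2 * p} : Multiset ℕ).sum + Multiset.card ({2 * p} : Multiset ℕ)) % 2 = 1 := by
        simp only [Multiset.sum_singleton, Multiset.card_singleton]
        omega
      omega
    · exact Or.inr rfl

theorem orderOf_eq_of_pow_critical (hn : 11 ≤ n) {φ : Perm (Fin n)} (hs : sign φ = 1) {a p : ℕ}
    (hp : p.Prime) (hc : IsCriticalType n p (φ ^ a).cycleType) : orderOf φ = p := by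
  have hodd : Odd p := hp.odd_of_ne_two (by obtain ⟨_, h⟩ | ⟨_, h⟩ := hc <;> omega)
  have hsplit := Multiset.filter_add_not (fun x => ¬ x ∣ a) φ.cycleType
  have hsupp := card_support_pow φ a
  have hle := φ.sum_cycleType_le
  rw [Fintype.card_fin, ← hsplit, Multiset.sum_add] at hle
  -- Each length `x` divides the order of `φ` and so `a * p`; if `p` did not divide `x`, then `x`
  -- would divide `a`.
  have hdvd : ∀ x ∈ φ.cycleType.filter (fun x => ¬ x ∣ a), p ∣ x := by
    intro x hx
    obtain ⟨hx1, hx2⟩ := Multiset.mem_filter.1 hx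
    have h1 : x ∣ a * p := by
      refine (dvd_of_mem_cycleType hx1).trans ?_
      rw [orderOf_dvd_iff_pow_eq_one, pow_mul, ← hc.orderOf, pow_orderOf_eq_one]
    by_contra hpx
    exact hx2 (((hp.coprime_iff_not_dvd.2 hpx).symm).dvd_of_dvd_mul_right h1)
  have htwo : ∀ q : ℕ → Prop, ∀ [DecidablePred q], ∀ x ∈ φ.cycleType.filter q, 2 ≤ x :=
    fun q _ x hx => two_le_of_mem_cycleType (Multiset.mem_of_mem_filter hx)
  rw [sign_of_cycleType, ← hsplit] at hs
  rw [← sum_cycleType] at hsupp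
  have hsum : (φ.cycleType.filter (fun x => ¬ x ∣ a)).sum = p ∧ n ≤ p + 2 ∨
      (φ.cycleType.filter (fun x => ¬ x ∣ a)).sum = 2 * p ∧ n ≤ 2 * p + 1 := by
    rw [← hsupp]
    obtain ⟨h, h'⟩ | ⟨h, h'⟩ := hc
    · exact Or.inl ⟨by rw [h, Multiset.sum_singleton], h'⟩
    · exact Or.inr ⟨by rw [h]; simp; omega, h'⟩
  have := multiset_add_eq_of_critical hodd (htwo _) (htwo _) hdvd hle hs hsum
  rw [hsplit] at this
  rw [← lcm_cycleType]
  obtain h | h := this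
  · rw [h]; simp
  · rw [h]; simp

theorem zpowers_eq_of_orderOf_pow_eq {G : Type*} [Group G] [Finite G] {x : G} {a : ℕ}
    (h : orderOf (x ^ a) = orderOf x) : Subgroup.zpowers (x ^ a) = Subgroup.zpowers x := by
  refine Subgroup.eq_of_le_of_card_ge ?_ ?_
  · rw [Subgroup.zpowers_le]
    exact Subgroup.npow_mem_zpowers x a
  · rw [Nat.card_zpowers, Nat.card_zpowers, h]

/-- The primes for which some permutation of `n` letters has critical cycle type. -/
def criticalPrimes (n : ℕ) : Set ℕ :=
  {p | p.Prime ∧ (p ≤ n ∧ n ≤ p + 2 ∨ 2 * p ≤ n ∧ n ≤ 2 * p + 1)}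

/-- The candidates are `n`, `n - 1`, `n - 2` and the integral one of `n / 2`, `(n - 1) / 2`. All
critical primes are at least 5, so multiples of 2 and of 3 drop out. -/
theorem encard_criticalPrimes_le (hn : 11 ≤ n) : (criticalPrimes n).encard ≤ 2 := by
  have key : ∀ a b : ℕ, criticalPrimes n ⊆ {a, b} → (criticalPrimes n).encard ≤ 2 :=
    fun a b h => (Set.encard_le_encard h).trans ((Set.encard_insert_le _ _).trans (by
      rw [Set.encard_singleton]; norm_num))
  have hodd : ∀ p ∈ criticalPrimes n, p % 2 = 1 := by
    rintro p ⟨hp, h⟩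
    exact hp.eq_two_or_odd.resolve_left (by omega)
  have hthree : ∀ p ∈ criticalPrimes n, p % 3 ≠ 0 := by
    rintro p ⟨hp, h⟩ h3
    have := (Nat.prime_dvd_prime_iff_eq Nat.prime_three hp).1 (Nat.dvd_of_mod_eq_zero h3)
    omega
  have hcases : ∀ p ∈ criticalPrimes n,
      p = n ∨ p + 1 = n ∨ p + 2 = n ∨ 2 * p = n ∨ 2 * p + 1 = n := by
    rintro p ⟨_, h⟩
    omega
  obtain h0 | h1 := Nat.mod_two_eq_zero_or_one n
  · refine key (n - 1) (n / 2) fun p hp => ?_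
    have := hodd p hp
    have := hcases p hp
    simp only [Set.mem_insert_iff, Set.mem_singleton_iff]
    omega
  · by_cases hA : n ∈ criticalPrimes n
    · by_cases hB : n - 2 ∈ criticalPrimes n
      -- If neither `n` nor `n - 2` is divisible by 3, then `n` is 1 modulo 3, so 3 divides `(n - 1)
      -- / 2`, which is thus not a critical prime.
      · refine key n (n - 2) fun p hp => ?_
        have := hodd p hp
        have := hcases p hp
        have := hthree _ hA
        have := hthree _ hB
        have : p % 3 = 1 ∨ p % 3 = 2 := by
          have := hthree p hp
          omega
        simp only [Set.mem_insert_iff, Set.mem_singleton_iff]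
        omega
      · refine key n (n / 2) fun p hp => ?_
        have := hodd p hp
        have := hcases p hp
        have : p ≠ n - 2 := by rintro rfl; exact hB hp
        simp only [Set.mem_insert_iff, Set.mem_singleton_iff]
        omega
    · refine key (n - 2) (n / 2) fun p hp => ?_
      have := hodd p hp
      have := hcases p hp
      have : p ≠ n := by rintro rfl; exact hA hp
      simp only [Set.mem_insert_iff, Set.mem_singleton_iff]
      omega

theorem IsCriticalType.mem_criticalPrimes {p : ℕ} {σ : Perm (Fin n)} (hp : p.Prime)
    (h : IsCriticalType n p σ.cycleType) : p ∈ criticalPrimes n :=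
  ⟨hp, h.le⟩

theorem exists_isCritical (hn : 11 ≤ n) (hA : n ∈ setA) :
    ∃ σ : Perm (Fin n), sign σ = 1 ∧ IsCritical σ := by
  have key : ∀ p : ℕ, ∀ m : Multiset ℕ, p.Prime → m.sum ≤ n → (∀ a ∈ m, 2 ≤ a) →
      IsCriticalType n p m → ∃ σ : Perm (Fin n), sign σ = 1 ∧ IsCritical σ := by
    intro p m hp hm h2 hc
    obtain ⟨σ, rfl⟩ := (exists_with_cycleType_iff (Fin n) (m := m)).2
      ⟨by rwa [Fintype.card_fin], h2⟩
    refine ⟨σ, ?_, p, hp, hc⟩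
    apply sign_of_odd_pow_eq_one (m := p)
    · exact hp.odd_of_ne_two (by obtain ⟨_, h⟩ | ⟨_, h⟩ := hc <;> omega)
    · rw [← hc.orderOf, pow_orderOf_eq_one]
  have key1 : ∀ p : ℕ, p.Prime → p ≤ n → n ≤ p + 2 →
      ∃ σ : Perm (Fin n), sign σ = 1 ∧ IsCritical σ := fun p hp h h' =>
    key p {p} hp (by simpa using h) (by simpa using hp.two_le) (Or.inl ⟨rfl, h'⟩)
  have key2 : ∀ p : ℕ, p.Prime → 2 * p ≤ n → n ≤ 2 * p + 1 →
      ∃ σ : Perm (Fin n), sign σ = 1 ∧ IsCritical σ := fun p hp h h' =>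
    key p {p, p} hp (by simp; omega) (by simpa using hp.two_le) (Or.inr ⟨rfl, h'⟩)
  obtain (((⟨p, hp, h⟩ | ⟨p, hp, h⟩) | ⟨p, hp, h⟩) | ⟨p, hp, h⟩) | ⟨p, hp, h⟩ := hA
  · exact key1 p hp (by omega) (by omega)
  · exact key1 p hp (by omega) (by omega)
  · exact key1 p hp (by omega) (by omega)
  · exact key2 p hp (by omega) (by omega)
  · exact key2 p hp (by omega) (by omega)

end Critical

/-! ### The main component and its counterparts in the four graphs -/

section MainComponent

open Equiv Equiv.Perm

variable {n : ℕ}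

theorem four_le (hn : 11 ≤ n) : 4 ≤ n :=
  le_trans (by decide) hn

theorem IsCritical.orderOf_prime {σ : Perm (Fin n)} (h : IsCritical σ) : (orderOf σ).Prime := by
  obtain ⟨p, hp, hc⟩ := h
  rwa [hc.orderOf]

theorem IsCritical.orderOf_mem {σ : Perm (Fin n)} (h : IsCritical σ) :
    orderOf σ ∈ criticalPrimes n := by
  obtain ⟨p, hp, hc⟩ := h
  rw [hc.orderOf]
  exact hc.mem_criticalPrimes hp

theorem not_isCritical_of_orderOf_lt (hn : 11 ≤ n) {σ : Perm (Fin n)} (h : orderOf σ < 5) :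
    ¬ IsCritical σ := by
  intro hc
  obtain ⟨_, h' | h'⟩ := hc.orderOf_mem <;> omega

theorem IsCritical.congr {σ τ : Perm (Fin n)} (h : IsCritical σ) (hστ : permType σ = permType τ) :
    IsCritical τ := by
  unfold IsCritical at *
  rwa [← permType_eq_iff.1 hστ]

/-- A nontrivial power of an element of prime order generates the same subgroup; in the other
direction, an element with a critical power already has that prime order. -/
theorem properCls_eq_of_pow_of_isCritical (hn : 11 ≤ n)
    {x y : {x : alternatingGroup (Fin n) // x ≠ 1}} (hc : IsCritical x.1.1) {m : ℕ}
    (h : y.1 = x.1 ^ m ∨ x.1 = y.1 ^ m) : properCls y = properCls x := by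
  rw [properCls_eq_iff]
  obtain h | h := h
  · rw [h]
    apply zpowers_eq_of_orderOf_pow_eq
    have hp : (orderOf x.1).Prime := by
      rw [← Subgroup.orderOf_coe]; exact hc.orderOf_prime
    refine (hp.eq_one_or_self_of_dvd _ (orderOf_pow_dvd m)).resolve_left fun h1 => ?_
    rw [← h, orderOf_eq_one_iff] at h1
    exact y.2 h1
  · rw [h]
    symm
    apply zpowers_eq_of_orderOf_pow_eq
    obtain ⟨p, hp, hc⟩ := hc
    have hx : x.1.1 = y.1.1 ^ m := congrArg Subtype.val h
    rw [hx] at hc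
    rw [← Subgroup.orderOf_coe, ← Subgroup.orderOf_coe,
      orderOf_eq_of_pow_critical hn (mem_alternatingGroup.1 y.1.2) hp hc]
    exact hc.orderOf

theorem permType_eq_of_properCls_eq {x y : {x : alternatingGroup (Fin n) // x ≠ 1}}
    (h : properCls x = properCls y) : permType x.1.1 = permType y.1.1 :=
  congrArg (fun c => (typeMap c).1.1) h

theorem not_adj_of_isCritical (hn : 11 ≤ n) {x : {x : alternatingGroup (Fin n) // x ≠ 1}}
    (hc : IsCritical x.1.1) (c : {c : CyclicClass (alternatingGroup (Fin n)) // c ≠ cls 1}) :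
    ¬ (properQuotientPowerGraph (alternatingGroup (Fin n))).Adj (properCls x) c := by
  intro h
  obtain ⟨x', y, hx, hy, _, m, hm⟩ := exists_of_properQuotientPowerGraph_adj h
  have hc' : IsCritical x'.1.1 := hc.congr (permType_eq_of_properCls_eq hx.symm)
  have := properCls_eq_of_pow_of_isCritical hn hc' hm.symm
  rw [hx, hy] at this
  exact h.ne this.symm

theorem linkedToDouble_of_not_isCritical (hn : 11 ≤ n) {σ : Perm (Fin n)} (hs : sign σ = 1)
    (h1 : σ ≠ 1) (hc : ¬ IsCritical σ) : LinkedToDouble σ := by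
  by_cases hp : (orderOf σ).Prime
  · exact linkedToDouble_of_prime_orderOf hn hs hp hc
  obtain ⟨q, hq, a, ha⟩ := Nat.exists_prime_and_dvd (mt orderOf_eq_one_iff.1 h1)
  have ha0 : a ≠ 0 := by
    rintro rfl
    exact (orderOf_pos σ).ne' (by rw [ha, mul_zero])
  have hord : orderOf (σ ^ a) = q := by
    rw [orderOf_pow_of_dvd ha0 ⟨q, by rw [ha, mul_comm]⟩, ha,
      Nat.mul_div_cancel _ (Nat.pos_of_ne_zero ha0)]
  have hne : σ ^ a ≠ 1 := by
    rw [Ne, ← orderOf_eq_one_iff, hord]; exact hq.ne_one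
  refine (altLinked_of_pow hs hne).linkedToDouble
    -- If the power of prime order were critical, `σ` itself would have prime order, the case
    -- already settled.
    (linkedToDouble_of_prime_orderOf hn (by rw [map_pow, hs, one_pow]) (by rwa [hord]) ?_)
  rintro ⟨p, hp', hcp⟩
  exact hp (by rwa [orderOf_eq_of_pow_critical hn hs hp' hcp])

theorem cycleType_doubleTransposition (hn : 4 ≤ n) :
    (doubleTransposition n hn).1.cycleType = {2, 2} := by
  apply cycleType_swap_mul_swap_of_nodup
  simp

theorem properCls_mem_mainComponent_iff (hn : 11 ≤ n)
    {x : {x : alternatingGroup (Fin n) // x ≠ 1}} :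
    properCls x ∈ (mainComponent n (four_le hn)).supp ↔ ¬ IsCritical x.1.1 := by
  have hd := cycleType_doubleTransposition (four_le hn)
  rw [SimpleGraph.ConnectedComponent.mem_supp_iff, mainComponent, SimpleGraph.ConnectedComponent.eq]
  constructor
  · intro h hc
    have h1 := eq_of_reachable_of_isolated (not_adj_of_isCritical hn hc) h
    refine not_isCritical_of_orderOf_lt hn ?_ (hc.congr (permType_eq_of_properCls_eq h1.symm))
    rw [orderOf_of_cycleType_eq_two_two hd]
    norm_num
  · intro hc
    obtain ⟨d, hd', h⟩ := linkedToDouble_of_not_isCritical hn (mem_alternatingGroup.1 x.1.2)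
      (fun h => x.2 (Subtype.ext h)) hc
    obtain ⟨x', y, hx, hy, h⟩ := h.trans (altLinked_of_cycleType_eq_two_two hn hd' hd)
    obtain rfl : x' = x := Subtype.ext (Subtype.ext hx)
    obtain rfl : y = ⟨doubleTransposition n (four_le hn), doubleTransposition_ne_one n (four_le hn)⟩ :=
      Subtype.ext (Subtype.ext hy)
    exact h

theorem exists_orderOf_eq_three (hn : 3 ≤ n) :
    ∃ x : {x : alternatingGroup (Fin n) // x ≠ 1}, orderOf x.1.1 = 3 := by
  obtain ⟨c, hc, _⟩ := exists_isThreeCycle_disjoint (n := n) (s := ∅) (by simpa using hn)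
  exact ⟨⟨⟨c, mem_alternatingGroup.2 hc.sign⟩, fun h => hc.ne_one (congrArg Subtype.val h)⟩,
    hc.orderOf⟩

/-- These two vertices witness that the main components are not complete, since neither of 2 and 3
divides the other. -/
theorem exists_orderOf_two_three (hn : 11 ≤ n) :
    ∃ x y : {x : alternatingGroup (Fin n) // x ≠ 1}, orderOf x.1.1 = 2 ∧ orderOf y.1.1 = 3 ∧
      properCls x ∈ (mainComponent n (four_le hn)).supp ∧
      properCls y ∈ (mainComponent n (four_le hn)).supp := by
  obtain ⟨y, hy⟩ := exists_orderOf_eq_three (n := n) (by omega)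
  have hx := orderOf_of_cycleType_eq_two_two (cycleType_doubleTransposition (four_le hn))
  refine ⟨⟨_, doubleTransposition_ne_one n (four_le hn)⟩, y, hx, hy, rfl, ?_⟩
  rw [properCls_mem_mainComponent_iff hn]
  exact not_isCritical_of_orderOf_lt hn (by omega)

theorem orderOf_dvd_or_dvd_of_pow {G : Type*} [Group G] {x y : G}
    (h : ∃ m : ℕ, x = y ^ m ∨ y = x ^ m) : orderOf x ∣ orderOf y ∨ orderOf y ∣ orderOf x := by
  obtain ⟨m, rfl | rfl⟩ := h
  · exact Or.inl (orderOf_pow_dvd m)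
  · exact Or.inr (orderOf_pow_dvd m)

theorem exists_isCritical_vertex (hn : 11 ≤ n) (hA : n ∈ setA) :
    ∃ x : {x : alternatingGroup (Fin n) // x ≠ 1}, IsCritical x.1.1 := by
  obtain ⟨σ, hs, hc⟩ := exists_isCritical hn hA
  refine ⟨⟨⟨σ, mem_alternatingGroup.2 hs⟩, fun h => ?_⟩, hc⟩
  have h1 : σ = 1 := congrArg Subtype.val h
  have := hc.orderOf_prime
  rw [h1, orderOf_one] at this
  exact Nat.not_prime_one this

theorem isCritical_of_connectedComponentMk_ne (hn : 11 ≤ n)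
    {x : {x : alternatingGroup (Fin n) // x ≠ 1}}
    (h : (properQuotientPowerGraph (alternatingGroup (Fin n))).connectedComponentMk (properCls x) ≠
      mainComponent n (four_le hn)) : IsCritical x.1.1 := by
  by_contra hc
  exact h ((properCls_mem_mainComponent_iff hn).2 hc)

/-! ### The proper quotient power graph -/

theorem exists_ne_mainComponent (hn : 11 ≤ n) (hA : n ∈ setA) :
    ∃ C, C ≠ mainComponent n (four_le hn) := by
  obtain ⟨x, hc⟩ := exists_isCritical_vertex hn hA
  exact ⟨_, fun h => (properCls_mem_mainComponent_iff hn).1 h hc⟩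

theorem quotientPowerGraph_others (hn : 11 ≤ n) :
    OthersIsolatedOfPrimeOrder (properQuotientPowerGraph (alternatingGroup (Fin n)))
      (fun c => (clsOrder c.1).1) (mainComponent n (four_le hn)) := by
  have key : ∀ C, C ≠ mainComponent n (four_le hn) →
      ∃ x : {x : alternatingGroup (Fin n) // x ≠ 1}, C.supp = {properCls x} ∧
        IsCritical x.1.1 := by
    intro C hC
    induction C using SimpleGraph.ConnectedComponent.ind with
    | h v =>
      obtain ⟨x, rfl⟩ := properCls_surjective v
      have hc := isCritical_of_connectedComponentMk_ne hn hC
      exact ⟨x, supp_eq_singleton_of_isolated (not_adj_of_isCritical hn hc), hc⟩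
  have hord : ∀ x : {x : alternatingGroup (Fin n) // x ≠ 1},
      (clsOrder (properCls x).1).1 = orderOf x.1.1 := fun x => (Subgroup.orderOf_coe x.1).symm
  refine ⟨fun C hC => ?_, (Set.encard_le_encard ?_).trans (encard_criticalPrimes_le hn)⟩
  · obtain ⟨x, hx, hc⟩ := key C hC
    exact ⟨_, hx, (congrArg Nat.Prime (hord x)).mpr hc.orderOf_prime⟩
  · rintro p ⟨C, hC, v, hv, rfl⟩
    obtain ⟨x, hx, hc⟩ := key C hC
    rw [hx, Set.mem_singleton_iff] at hv
    subst hv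
    dsimp only
    rw [hord]
    exact hc.orderOf_mem

theorem quotientPowerGraph_not_complete (hn : 11 ≤ n) :
    ¬ IsCompleteComponent (properQuotientPowerGraph (alternatingGroup (Fin n)))
      (mainComponent n (four_le hn)) := by
  intro h
  obtain ⟨x, y, hx, hy, hxm, hym⟩ := exists_orderOf_two_three hn
  have hne : properCls x ≠ properCls y := by
    intro h'
    have := orderOf_eq_of_zpowers_eq (properCls_eq_iff.1 h')
    rw [← Subgroup.orderOf_coe, ← Subgroup.orderOf_coe, hx, hy] at this
    norm_num at this
  obtain ⟨x', y', hx', hy', _, hm⟩ :=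
    exists_of_properQuotientPowerGraph_adj (h _ hxm _ hym hne)
  have := orderOf_dvd_or_dvd_of_pow hm
  rw [orderOf_eq_of_zpowers_eq (properCls_eq_iff.1 hx'),
    orderOf_eq_of_zpowers_eq (properCls_eq_iff.1 hy'),
    ← Subgroup.orderOf_coe, ← Subgroup.orderOf_coe, hx, hy] at this
  norm_num at this

/-! ### The proper power graph -/

/-- In a group of prime order every nontrivial element is a generator. -/
theorem ncard_generators {G : Type*} [Group G] [Finite G] {x : {x : G // x ≠ 1}}
    (hp : (orderOf x.1).Prime) :
    {y : {x : G // x ≠ 1} | properCls y = properCls x}.ncard = orderOf x.1 - 1 := by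
  have himage : Subtype.val '' {y : {x : G // x ≠ 1} | properCls y = properCls x} =
      (Subgroup.zpowers x.1 : Set G) \ {1} := by
    ext y
    simp only [Set.mem_image, Set.mem_ofPred_eq, Set.mem_sdiff, SetLike.mem_coe,
      Set.mem_singleton_iff]
    constructor
    · rintro ⟨y, hy, rfl⟩
      rw [properCls_eq_iff] at hy
      exact ⟨hy ▸ Subgroup.mem_zpowers y.1, y.2⟩
    · rintro ⟨hy, hy1⟩
      refine ⟨⟨y, hy1⟩, properCls_eq_iff.2 ?_, rfl⟩
      obtain ⟨m, rfl⟩ := mem_powers_iff_mem_zpowers.2 hy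
      apply zpowers_eq_of_orderOf_pow_eq
      exact (hp.eq_one_or_self_of_dvd _ (orderOf_pow_dvd m)).resolve_left
        fun h => hy1 (orderOf_eq_one_iff.1 h)
  rw [← Set.ncard_image_of_injective _ Subtype.val_injective, himage,
    Set.ncard_sdiff_singleton_of_mem (one_mem _), ← Nat.card_zpowers]
  rfl

theorem supp_properPowerGraph {G : Type*} [Group G] [Finite G] (x : {x : G // x ≠ 1}) :
    ((properPowerGraph G).connectedComponentMk x).supp =
      {y | properCls y ∈ ((properQuotientPowerGraph G).connectedComponentMk (properCls x)).supp} := by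
  ext y
  rw [Set.mem_ofPred_eq, SimpleGraph.ConnectedComponent.mem_supp_iff,
    SimpleGraph.ConnectedComponent.mem_supp_iff, SimpleGraph.ConnectedComponent.eq,
    SimpleGraph.ConnectedComponent.eq, properPowerGraph_reachable_iff]

theorem powerGraph_main (hn : 11 ≤ n) (hA : n ∈ setA) :
    ∃ M : (properPowerGraph (alternatingGroup (Fin n))).ConnectedComponent,
      M.supp = {ψ | properCls ψ ∈ (mainComponent n (four_le hn)).supp} ∧
      (∃ C, C ≠ M) ∧
      OthersCompleteOfPrime (properPowerGraph (alternatingGroup (Fin n))) M ∧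
      ¬ IsCompleteComponent (properPowerGraph (alternatingGroup (Fin n))) M := by
  obtain ⟨M, hM⟩ : ∃ M : (properPowerGraph (alternatingGroup (Fin n))).ConnectedComponent,
      M.supp = {ψ | properCls ψ ∈ (mainComponent n (four_le hn)).supp} :=
    ⟨_, supp_properPowerGraph _⟩
  have hmem : ∀ x, (properPowerGraph (alternatingGroup (Fin n))).connectedComponentMk x = M ↔
      ¬ IsCritical x.1.1 := by
    intro x
    rw [← properCls_mem_mainComponent_iff hn, ← SimpleGraph.ConnectedComponent.mem_supp_iff, hM]
    rfl
  have key : ∀ C, C ≠ M → ∃ x : {x : alternatingGroup (Fin n) // x ≠ 1},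
      C.supp = {y | properCls y = properCls x} ∧ IsCritical x.1.1 := by
    intro C hC
    induction C using SimpleGraph.ConnectedComponent.ind with
    | h x =>
      have hc : IsCritical x.1.1 := by
        by_contra h
        exact hC ((hmem x).2 h)
      refine ⟨x, ?_, hc⟩
      rw [supp_properPowerGraph, supp_eq_singleton_of_isolated (not_adj_of_isCritical hn hc)]
      rfl
  have hcard : ∀ x : {x : alternatingGroup (Fin n) // x ≠ 1}, IsCritical x.1.1 →
      {y | properCls y = properCls x}.ncard = orderOf x.1.1 - 1 := by
    intro x hc
    rw [Subgroup.orderOf_coe]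
    apply ncard_generators
    rw [← Subgroup.orderOf_coe]
    exact hc.orderOf_prime
  refine ⟨M, hM, ?_, ⟨fun C hC => ?_, (Set.encard_le_encard ?_).trans
    (encard_criticalPrimes_le hn)⟩, fun h => ?_⟩
  · obtain ⟨x, hc⟩ := exists_isCritical_vertex hn hA
    exact ⟨_, fun h => (hmem x).1 h hc⟩
  · obtain ⟨x, hx, hc⟩ := key C hC
    refine ⟨fun y hy z hz hyz => ?_, _, hc.orderOf_prime, hx ▸ hcard x hc⟩
    rw [hx] at hy hz
    obtain ⟨m, hm⟩ := exists_pow_eq_of_zpowers_eq (properCls_eq_iff.1 (hy.trans hz.symm))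
    exact ⟨fun h => hyz (Subtype.ext h), m, Or.inr hm⟩
  · rintro p ⟨hp, C, hC, hp'⟩
    obtain ⟨x, hx, hc⟩ := key C hC
    rw [hx, hcard x hc] at hp'
    -- Both primes are at least 2, so truncated subtraction of 1 loses nothing and the component
    -- size determines the prime.
    have h1 := hp.two_le
    have h2 := hc.orderOf_prime.two_le
    obtain rfl : p = orderOf x.1.1 := by omega
    exact hc.orderOf_mem
  · obtain ⟨x, y, hx, hy, hxm, hym⟩ := exists_orderOf_two_three hn
    have hne : x ≠ y := by
      rintro rfl
      omega
    obtain ⟨_, hm⟩ := h x (hM ▸ hxm) y (hM ▸ hym) hne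
    have := orderOf_dvd_or_dvd_of_pow hm
    rw [← Subgroup.orderOf_coe, ← Subgroup.orderOf_coe, hx, hy] at this
    norm_num at this

/-! ### The proper power type graph -/

theorem typeMap_properCls_surjective (T : {T : typeSet (alternatingGroup (Fin n)) //
    T ≠ typeOne (alternatingGroup (Fin n))}) :
    ∃ x : {x : alternatingGroup (Fin n) // x ≠ 1}, typeMap (properCls x) = T := by
  obtain ⟨⟨_, x, rfl⟩, hT⟩ := T
  refine ⟨⟨x, ?_⟩, rfl⟩
  rintro rfl
  exact hT (Subtype.ext permType_one)

/-- Take any representative of the type that is raised to the power `a`; by `permType_pow` its own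
power `a` represents the other type, and is nontrivial because that type is. -/
theorem exists_pow_of_properPowerTypeGraph_adj {S T : {T : typeSet (alternatingGroup (Fin n)) //
    T ≠ typeOne (alternatingGroup (Fin n))}}
    (h : (properPowerTypeGraph (alternatingGroup (Fin n))).Adj S T) :
    ∃ x y : {x : alternatingGroup (Fin n) // x ≠ 1}, typeMap (properCls x) = S ∧
      typeMap (properCls y) = T ∧ ∃ m : ℕ, x.1 = y.1 ^ m ∨ y.1 = x.1 ^ m := by
  have key : ∀ S T : {T : typeSet (alternatingGroup (Fin n)) //
      T ≠ typeOne (alternatingGroup (Fin n))}, ∀ a : ℕ, S.1.1 = partitionPow T.1.1 a →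
      ∃ x y : {x : alternatingGroup (Fin n) // x ≠ 1}, typeMap (properCls x) = S ∧
        typeMap (properCls y) = T ∧ x.1 = y.1 ^ a := by
    intro S T a ha
    obtain ⟨y, rfl⟩ := typeMap_properCls_surjective T
    have hS : permType (y.1 ^ a).1 = S.1.1 := by
      rw [ha, Subgroup.coe_pow, permType_pow]
      rfl
    refine ⟨⟨y.1 ^ a, fun h => S.2 (Subtype.ext ?_)⟩, y, Subtype.ext (Subtype.ext hS), rfl, rfl⟩
    rw [h] at hS
    exact hS.symm.trans permType_one
  obtain ⟨_, a, ha | ha⟩ := h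
  · obtain ⟨x, y, hx, hy, hxy⟩ := key S T a ha
    exact ⟨x, y, hx, hy, a, Or.inl hxy⟩
  · obtain ⟨x, y, hx, hy, hxy⟩ := key T S a ha
    exact ⟨y, x, hy, hx, a, Or.inr hxy⟩

theorem properPowerTypeGraph_adj_of_pow {x y : {x : alternatingGroup (Fin n) // x ≠ 1}}
    (h : ∃ m : ℕ, x.1 = y.1 ^ m ∨ y.1 = x.1 ^ m)
    (hne : typeMap (properCls x) ≠ typeMap (properCls y)) :
    (properPowerTypeGraph (alternatingGroup (Fin n))).Adj (typeMap (properCls x))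
      (typeMap (properCls y)) := by
  obtain ⟨m, hm⟩ := h
  refine ⟨fun h => hne (Subtype.ext h), m, hm.imp (fun hm => ?_) fun hm => ?_⟩
  · change permType x.1.1 = partitionPow (permType y.1.1) m
    rw [← permType_pow, hm, Subgroup.coe_pow]
  · change permType y.1.1 = partitionPow (permType x.1.1) m
    rw [← permType_pow, hm, Subgroup.coe_pow]

theorem properQuotientPowerGraph_adj_of_exists_pow {G : Type*} [Group G] {x y : {x : G // x ≠ 1}}
    (h : ∃ m : ℕ, x.1 = y.1 ^ m ∨ y.1 = x.1 ^ m) (hne : properCls x ≠ properCls y) :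
    (properQuotientPowerGraph G).Adj (properCls x) (properCls y) := by
  obtain ⟨m, hm | hm⟩ := h
  · exact (properQuotientPowerGraph_adj_of_pow hm hne.symm).symm
  · exact properQuotientPowerGraph_adj_of_pow hm hne

theorem permType_eq_of_typeMap_eq {x y : {x : alternatingGroup (Fin n) // x ≠ 1}}
    (h : typeMap (properCls x) = typeMap (properCls y)) : permType x.1.1 = permType y.1.1 :=
  congrArg (fun T => T.1.1) h

theorem powerTypeGraph_main (hn : 11 ≤ n) (hA : n ∈ setA) :
    ∃ M : (properPowerTypeGraph (alternatingGroup (Fin n))).ConnectedComponent,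
      IsImageOfComponent (properQuotientPowerGraph (alternatingGroup (Fin n)))
        (properPowerTypeGraph (alternatingGroup (Fin n))) typeMap
        (mainComponent n (four_le hn)) M ∧
      (∃ C, C ≠ M) ∧
      OthersIsolatedOfPrimeOrder (properPowerTypeGraph (alternatingGroup (Fin n)))
        (fun T => partitionOrder T.1.1) M ∧
      ¬ IsCompleteComponent (properPowerTypeGraph (alternatingGroup (Fin n))) M := by
  obtain ⟨M, hM⟩ : ∃ M, IsImageOfComponent (properQuotientPowerGraph (alternatingGroup (Fin n)))
      (properPowerTypeGraph (alternatingGroup (Fin n))) typeMap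
      (mainComponent n (four_le hn)) M := by
    refine ⟨_, isImageOfComponent_of_lift _ (fun c d hcd hne => ?_) fun c hc T hT => ?_⟩
    · obtain ⟨x, y, rfl, rfl, _, hm⟩ := exists_of_properQuotientPowerGraph_adj hcd
      exact properPowerTypeGraph_adj_of_pow hm hne
    · change c ∈ (mainComponent n (four_le hn)).supp at hc
      obtain ⟨z, rfl⟩ := properCls_surjective c
      rw [properCls_mem_mainComponent_iff hn] at hc
      obtain ⟨x, y, hx, hy, hm⟩ := exists_pow_of_properPowerTypeGraph_adj hT
      have hadj := properQuotientPowerGraph_adj_of_exists_pow hm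
        (fun h => hT.ne (by rw [← hx, ← hy, h]))
      -- The representative `x` may lie in another class than `z`, but it has the same type, so it
      -- is noncritical too and belongs to the main component.
      have hxm : properCls x ∈ (mainComponent n (four_le hn)).supp :=
        (properCls_mem_mainComponent_iff hn).2
          fun h => hc (h.congr (permType_eq_of_typeMap_eq hx))
      exact ⟨_, hxm, _, SimpleGraph.ConnectedComponent.mem_supp_of_adj_mem_supp _ hxm hadj,
        hadj, hx, hy⟩
  have hmem : ∀ x : {x : alternatingGroup (Fin n) // x ≠ 1},
      typeMap (properCls x) ∈ M.supp ↔ ¬ IsCritical x.1.1 := by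
    intro x
    rw [← hM.1]
    constructor
    · rintro ⟨c, hc, h⟩ hx
      obtain ⟨y, rfl⟩ := properCls_surjective c
      exact (properCls_mem_mainComponent_iff hn).1 hc
        (hx.congr (permType_eq_of_typeMap_eq h.symm))
    · exact fun h => ⟨_, (properCls_mem_mainComponent_iff hn).2 h, rfl⟩
  have hisol : ∀ x : {x : alternatingGroup (Fin n) // x ≠ 1}, IsCritical x.1.1 →
      ∀ T, ¬ (properPowerTypeGraph (alternatingGroup (Fin n))).Adj (typeMap (properCls x)) T := by
    intro x hc T hT
    obtain ⟨x', y, hx, rfl, hm⟩ := exists_pow_of_properPowerTypeGraph_adj hT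
    refine not_adj_of_isCritical hn (hc.congr (permType_eq_of_typeMap_eq hx.symm)) _
      (properQuotientPowerGraph_adj_of_exists_pow hm ?_)
    intro h
    exact hT.ne (by rw [← hx, h])
  have key : ∀ C, C ≠ M → ∃ x : {x : alternatingGroup (Fin n) // x ≠ 1},
      C.supp = {typeMap (properCls x)} ∧ IsCritical x.1.1 := by
    intro C hC
    induction C using SimpleGraph.ConnectedComponent.ind with
    | h T =>
      obtain ⟨x, rfl⟩ := typeMap_properCls_surjective T
      have hc : IsCritical x.1.1 := by
        by_contra h
        exact hC ((hmem x).2 h)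
      exact ⟨x, supp_eq_singleton_of_isolated (hisol x hc), hc⟩
  have hord : ∀ x : {x : alternatingGroup (Fin n) // x ≠ 1},
      partitionOrder (typeMap (properCls x)).1.1 = orderOf x.1.1 :=
    fun x => partitionOrder_permType x.1.1
  refine ⟨M, hM, ?_, ⟨fun C hC => ?_, (Set.encard_le_encard ?_).trans
    (encard_criticalPrimes_le hn)⟩, fun h => ?_⟩
  · obtain ⟨x, hc⟩ := exists_isCritical_vertex hn hA
    exact ⟨_, fun h => (hmem x).1 h hc⟩
  · obtain ⟨x, hx, hc⟩ := key C hC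
    exact ⟨_, hx, (congrArg Nat.Prime (hord x)).mpr hc.orderOf_prime⟩
  · rintro p ⟨C, hC, v, hv, rfl⟩
    obtain ⟨x, hx, hc⟩ := key C hC
    rw [hx, Set.mem_singleton_iff] at hv
    subst hv
    dsimp only
    rw [hord]
    exact hc.orderOf_mem
  · obtain ⟨x, y, hx, hy, hxm, hym⟩ := exists_orderOf_two_three hn
    have hne : typeMap (properCls x) ≠ typeMap (properCls y) := by
      intro h'
      have := congrArg (fun T => partitionOrder T.1.1) h'
      rw [hord, hord] at this
      omega
    obtain ⟨x', y', hx', hy', hm⟩ := exists_pow_of_properPowerTypeGraph_adj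
      (h _ (hM.1 ▸ ⟨_, hxm, rfl⟩) _ (hM.1 ▸ ⟨_, hym, rfl⟩) hne)
    have := orderOf_dvd_or_dvd_of_pow hm
    rw [← Subgroup.orderOf_coe, ← Subgroup.orderOf_coe, ← hord x', ← hord y', hx', hy', hord, hord,
      hx, hy] at this
    norm_num at this

/-! ### The proper order graph -/

theorem orderMap_properCls_surjective {G : Type*} [Group G]
    (m : {m : orderSet G // m ≠ orderOne G}) :
    ∃ x : {x : G // x ≠ 1}, orderMap (properCls x) = m := by
  obtain ⟨⟨_, x, rfl⟩, hm⟩ := m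
  refine ⟨⟨x, ?_⟩, rfl⟩
  rintro rfl
  exact hm (Subtype.ext orderOf_one)

theorem orderMap_eq_iff {G : Type*} [Group G] {x y : {x : G // x ≠ 1}} :
    orderMap (properCls x) = orderMap (properCls y) ↔ orderOf x.1 = orderOf y.1 := by
  rw [Subtype.ext_iff, Subtype.ext_iff]
  rfl

theorem exists_pow_orderOf_eq {G : Type*} [Group G] [Finite G] (x : {x : G // x ≠ 1}) {m : ℕ}
    (hm : m ∣ orderOf x.1) (hm1 : m ≠ 1) :
    ∃ y : {x : G // x ≠ 1}, orderOf y.1 = m ∧ ∃ a : ℕ, y.1 = x.1 ^ a := by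
  obtain ⟨a, ha⟩ := hm
  have ha0 : a ≠ 0 := by
    rintro rfl
    exact (orderOf_pos x.1).ne' (by rw [ha, mul_zero])
  have hord : orderOf (x.1 ^ a) = m := by
    rw [orderOf_pow_of_dvd ha0 ⟨m, by rw [ha, mul_comm]⟩, ha,
      Nat.mul_div_cancel _ (Nat.pos_of_ne_zero ha0)]
  refine ⟨⟨x.1 ^ a, ?_⟩, hord, a, rfl⟩
  rwa [Ne, ← orderOf_eq_one_iff, hord]

theorem properOrderGraph_adj_iff {G : Type*} [Group G] {x y : {x : G // x ≠ 1}} :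
    (properOrderGraph G).Adj (orderMap (properCls x)) (orderMap (properCls y)) ↔
      orderOf x.1 ≠ orderOf y.1 ∧ (orderOf x.1 ∣ orderOf y.1 ∨ orderOf y.1 ∣ orderOf x.1) := by
  rw [Ne, ← orderMap_eq_iff, Subtype.ext_iff]
  rfl

theorem orderGraph_main (hn : 11 ≤ n) :
    ∃ M : (properOrderGraph (alternatingGroup (Fin n))).ConnectedComponent,
      IsImageOfComponent (properQuotientPowerGraph (alternatingGroup (Fin n)))
        (properOrderGraph (alternatingGroup (Fin n))) orderMap
        (mainComponent n (four_le hn)) M ∧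
      OthersIsolatedOfPrimeOrder (properOrderGraph (alternatingGroup (Fin n)))
        (fun m => m.1.1) M ∧
      ¬ IsCompleteComponent (properOrderGraph (alternatingGroup (Fin n))) M := by
  -- A critical element has prime order, which has no proper divisor other than 1.
  have hmult : ∀ x y : {x : alternatingGroup (Fin n) // x ≠ 1}, orderOf x.1 ∣ orderOf y.1 →
      orderOf x.1 ≠ orderOf y.1 → ¬ IsCritical y.1.1 := by
    intro x y hdvd hne hc
    have hp := hc.orderOf_prime
    rw [Subgroup.orderOf_coe] at hp
    obtain h | h := hp.eq_one_or_self_of_dvd _ hdvd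
    · exact x.2 (orderOf_eq_one_iff.1 h)
    · exact hne h
  have hadj : ∀ x y : {x : alternatingGroup (Fin n) // x ≠ 1}, ¬ IsCritical y.1.1 →
      orderOf x.1 ∣ orderOf y.1 → orderOf x.1 ≠ orderOf y.1 →
      ∃ x' : {x : alternatingGroup (Fin n) // x ≠ 1}, orderOf x'.1 = orderOf x.1 ∧
        properCls x' ∈ (mainComponent n (four_le hn)).supp ∧
        (properQuotientPowerGraph (alternatingGroup (Fin n))).Adj (properCls x')
          (properCls y) := by
    intro x y hy hdvd hne
    obtain ⟨x', hx', a, ha⟩ := exists_pow_orderOf_eq y hdvd (mt orderOf_eq_one_iff.1 x.2)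
    have h := properQuotientPowerGraph_adj_of_exists_pow (x := x') (y := y) ⟨a, Or.inl ha⟩
      (fun h => hne (by rw [← hx', orderOf_eq_of_zpowers_eq (properCls_eq_iff.1 h)]))
    exact ⟨x', hx', SimpleGraph.ConnectedComponent.mem_supp_of_adj_mem_supp _
      ((properCls_mem_mainComponent_iff hn).2 hy) h.symm, h⟩
  obtain ⟨M, hM⟩ : ∃ M, IsImageOfComponent (properQuotientPowerGraph (alternatingGroup (Fin n)))
      (properOrderGraph (alternatingGroup (Fin n))) orderMap
      (mainComponent n (four_le hn)) M := by
    refine ⟨_, isImageOfComponent_of_lift _ (fun c d hcd hne => ?_) fun c hc m hm => ?_⟩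
    · obtain ⟨x, y, rfl, rfl, _, hm⟩ := exists_of_properQuotientPowerGraph_adj hcd
      exact properOrderGraph_adj_iff.2 ⟨orderMap_eq_iff.not.1 hne, orderOf_dvd_or_dvd_of_pow hm⟩
    · change c ∈ (mainComponent n (four_le hn)).supp at hc
      obtain ⟨x, rfl⟩ := properCls_surjective c
      obtain ⟨y, rfl⟩ := orderMap_properCls_surjective m
      obtain ⟨hne, h | h⟩ := properOrderGraph_adj_iff.1 hm
      -- The element of larger order is kept and the other is replaced by a power of it of the
      -- required order; this changes the class but not the vertex of the order graph.
      · have hy := hmult x y h hne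
        obtain ⟨x', hx', hx'm, h'⟩ := hadj x y hy h hne
        exact ⟨_, hx'm, _, (properCls_mem_mainComponent_iff hn).2 hy, h',
          orderMap_eq_iff.2 hx', rfl⟩
      · obtain ⟨y', hy', hy'm, h'⟩ :=
          hadj y x ((properCls_mem_mainComponent_iff hn).1 hc) h hne.symm
        exact ⟨_, hc, _, hy'm, h'.symm, rfl, orderMap_eq_iff.2 hy'⟩
  -- Only this implication holds: when `2 * p ≤ n`, a critical `p` is also the order of a
  -- noncritical `p`-cycle.
  have hmem : ∀ x : {x : alternatingGroup (Fin n) // x ≠ 1}, ¬ IsCritical x.1.1 →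
      orderMap (properCls x) ∈ M.supp := by
    intro x hx
    rw [← hM.1]
    exact ⟨_, (properCls_mem_mainComponent_iff hn).2 hx, rfl⟩
  have key : ∀ C, C ≠ M → ∃ x : {x : alternatingGroup (Fin n) // x ≠ 1},
      C.supp = {orderMap (properCls x)} ∧ IsCritical x.1.1 := by
    intro C hC
    induction C using SimpleGraph.ConnectedComponent.ind with
    | h m =>
      obtain ⟨x, rfl⟩ := orderMap_properCls_surjective m
      have hc : IsCritical x.1.1 := by
        by_contra h
        exact hC (hmem x h)
      refine ⟨x, supp_eq_singleton_of_isolated fun m' hm' => ?_, hc⟩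
      obtain ⟨y, rfl⟩ := orderMap_properCls_surjective m'
      obtain ⟨hne, h | h⟩ := properOrderGraph_adj_iff.1 hm'
      -- A proper multiple of the order would be a vertex of `M`, and this would put `C` into `M`.
      · have hym := hmem y (hmult x y h hne)
        exact hC (SimpleGraph.ConnectedComponent.mem_supp_of_adj_mem_supp _ hym hm'.symm)
      · exact hmult y x h hne.symm hc
  have hord : ∀ x : {x : alternatingGroup (Fin n) // x ≠ 1},
      (orderMap (properCls x)).1.1 = orderOf x.1.1 := fun x => (Subgroup.orderOf_coe x.1).symm
  refine ⟨M, hM, ⟨fun C hC => ?_, (Set.encard_le_encard ?_).trans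
    (encard_criticalPrimes_le hn)⟩, fun h => ?_⟩
  · obtain ⟨x, hx, hc⟩ := key C hC
    exact ⟨_, hx, (congrArg Nat.Prime (hord x)).mpr hc.orderOf_prime⟩
  · rintro p ⟨C, hC, v, hv, rfl⟩
    obtain ⟨x, hx, hc⟩ := key C hC
    rw [hx, Set.mem_singleton_iff] at hv
    subst hv
    dsimp only
    rw [hord]
    exact hc.orderOf_mem
  · obtain ⟨x, y, hx, hy, hxm, hym⟩ := exists_orderOf_two_three hn
    rw [Subgroup.orderOf_coe] at hx hy
    have := h (orderMap (properCls x)) (hM.1 ▸ ⟨_, hxm, rfl⟩) (orderMap (properCls y))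
      (hM.1 ▸ ⟨_, hym, rfl⟩) (fun h' => by have := orderMap_eq_iff.1 h'; omega)
    rw [properOrderGraph_adj_iff, hx, hy] at this
    norm_num at this

end MainComponent

end AltPowerGraphs

theorem theoremB (n : ℕ) (hn : 11 ≤ n) (hA : n ∈ setA) :
    -- (i) the proper quotient power graph
    ((∃ C, C ≠ mainComponent n (by omega)) ∧
      OthersIsolatedOfPrimeOrder
        (properQuotientPowerGraph (alternatingGroup (Fin n)))
        (fun c => (clsOrder c.1).1)
        (mainComponent n (by omega)) ∧
      ¬ IsCompleteComponent
        (properQuotientPowerGraph (alternatingGroup (Fin n)))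
        (mainComponent n (by omega))) ∧
    -- (ii) the proper power graph
    (∃ M : (properPowerGraph (alternatingGroup (Fin n))).ConnectedComponent,
      M.supp = {ψ | properCls ψ ∈
        (mainComponent n (by omega)).supp} ∧
      (∃ C, C ≠ M) ∧
      OthersCompleteOfPrime
        (properPowerGraph (alternatingGroup (Fin n))) M ∧
      ¬ IsCompleteComponent
        (properPowerGraph (alternatingGroup (Fin n))) M) ∧
    -- (iii) the proper power type graph
    (∃ M : (properPowerTypeGraph (alternatingGroup (Fin n))).ConnectedComponent,
      IsImageOfComponent
        (properQuotientPowerGraph (alternatingGroup (Fin n)))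
        (properPowerTypeGraph (alternatingGroup (Fin n)))
        typeMap (mainComponent n (by omega)) M ∧
      (∃ C, C ≠ M) ∧
      OthersIsolatedOfPrimeOrder
        (properPowerTypeGraph (alternatingGroup (Fin n)))
        (fun T => partitionOrder T.1.1) M ∧
      ¬ IsCompleteComponent
        (properPowerTypeGraph (alternatingGroup (Fin n))) M) ∧
    -- (iv) the proper order graph
    (∃ M : (properOrderGraph (alternatingGroup (Fin n))).ConnectedComponent,
      IsImageOfComponent
        (properQuotientPowerGraph (alternatingGroup (Fin n)))
        (properOrderGraph (alternatingGroup (Fin n)))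
        orderMap (mainComponent n (by omega)) M ∧
      OthersIsolatedOfPrimeOrder
        (properOrderGraph (alternatingGroup (Fin n)))
        (fun m => m.1.1) M ∧
      ¬ IsCompleteComponent
        (properOrderGraph (alternatingGroup (Fin n))) M) :=
  ⟨⟨exists_ne_mainComponent hn hA, quotientPowerGraph_others hn, quotientPowerGraph_not_complete hn⟩,
    powerGraph_main hn hA, powerTypeGraph_main hn hA, orderGraph_main hn⟩
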